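/- Let $\mathbb{X}$ be a finite-dimensional real inner product space and let $\mathbb{S}^n$ be the space of real symmetric $n\times n$ matrices with the Frobenius inner product $\langle A,B\rangle={\rm tr}(A^TB)$; let $\mathbb{S}^n_+$, $\mathbb{S}^n_-$ be the cones of positive and negative semidefinite matrices. Let $f:\mathbb{X}\to\mathbb{R}$ and $G:\mathbb{X}\to\mathbb{S}^n$ be twice continuously differentiable, and consider the nonlinear semidefinite program $\min f(x)$ subject to $G(x)\in\mathbb{S}^n_+$, with Lagrangian $L(x,Y)=f(x)+\langle Y,G(x)\rangle$. Definitions. For a set $C$ in a Euclidean space $\mathbb{Y}$, $\delta_C$ is its indicator function ($0$ on $C$, $+\infty$ off $C$), $\mathcal{T}_C(x)=\{d\mid \exists\,t^k\downarrow0,\ d^k\to d,\ x+t^kd^k\in C\ \forall k\}$ is its contingent cone, and $\mathcal{C}_C(x,y)=\mathcal{T}_C(x)\cap\{y\}^\perp$ is its critical cone. For $g:\mathbb{Y}\to[-\infty,+\infty]$ finite at $x$, $\partial^\pi g(x)$ is the set of $d$ for which there are $l,r>0$ with $g(z)\ge g(x)+\langle d,z-x\rangle-l\|z-x\|^2$ whenever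 $\|z-x\|<r$; $\partial g(x)$ is the set of limits $d=\lim d_k$ with $d_k\in\partial^\pi g(x_k)$, $x_k\to x$, $g(x_k)\to g(x)$; both sets are empty where $g$ is not finite. Put $\Delta_t^2g(x\mid v)(u)=\dfrac{g(x+tu)-g(x)-t\langle v,u\rangle}{t^2/2}$ and $d^2g(x\mid v)(w)=\liminf_{t\downarrow0,\,u\to w}\Delta_t^2g(x\mid v)(u)$; $g$ is twice epi-differentiable at $x$ for $v$ if $\Delta_t^2g(x\mid v)$ epi-converges to $d^2g(x\mid v)$ as $t\downarrow0$. A generalized quadratic form is a function $q:\mathbb{Y}\to(-\infty,+\infty]$ with $q(0)=0$ such that the graph of $\partial q$ is a linear subspace of $\mathbb{Y}\times\mathbb{Y}$. The function $g$ is generalized twice differentiable at $x$ for $y\in\partial g(x)$ if it is twice epi-differentiable at $x$ for $y$ and $d^2g(x\mid y)$ is a generalized quadratic form. The quadratic bundle ${\rm quad}\,\theta(x\mid y)$ is the set of generalized quadratic forms $q$ for which there exist $(x^k,y^k)\to(x,y)$ such that $\theta$ is generalized twice differentiable at $x^k$ for $y^k$ for every $k$ and $\tfrac12d^2\theta(x^k\mid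 y^k)$ epi-converges to $q$. For $X,Y,H\in\mathbb{S}^n$ the $\sigma$-term is $\varUpsilon_X(Y,H)=2\langle Y,HX^\dagger H\rangle$, where $X^\dagger$ is the Moore–Penrose inverse of $X$. Proposition. Let $(\bar x,\overline Y)\in\mathbb{X}\times\mathbb{S}^n$ be a KKT pair, that is, $L'_x(\bar x,\overline Y)=0$, $G(\bar x)\in\mathbb{S}^n_+$, $\overline Y\in\mathbb{S}^n_-$ and $\langle G(\bar x),\overline Y\rangle=0$. Then there exists $q\in{\rm quad}\,\delta_{\mathbb{S}^n_+}(G(\bar x)\mid\overline Y)$ such that $$q(H)=-\tfrac12\varUpsilon_{G(\bar x)}(\overline Y,H)+\delta_{{\rm aff}\,\mathcal{C}_{\mathbb{S}^n_+}(G(\bar x),\overline Y)}(H)\qquad\text{for all }H\in\mathbb{S}^n,$$ where ${\rm aff}$ denotes the affine hull. Moreover, for every eigenvalue decomposition $G(\bar x)+\overline Y=P\,{\rm Diag}(\lambda)P^T$ with $P$ orthogonal and $\lambda_1\ge\dots\ge\lambda_n$, writing $\alpha=\{i\mid\lambda_i>0\}$, $\gamma=\{j\mid\lambda_j<0\}$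 and $\widetilde H=P^THP$, $$q(H)=\sum_{i\in\alpha,\,j\in\gamma}\frac{-\lambda_j}{\lambda_i}\,\widetilde H_{ij}^2+\delta_{{\rm aff}\,\mathcal{C}_{\mathbb{S}^n_+}(G(\bar x),\overline Y)}(H)\qquad\text{for all }H\in\mathbb{S}^n.$$ -/

import Mathlib

open Filter Topology Finset
open scoped RealInnerProductSpace Matrix

namespace NLSDP

/-! ### The Euclidean space of real symmetric matrices -/

/-- The subspace of symmetric matrices in the space of real `n × n` matrices. -/
def symSubmodule (n : ℕ) : Submodule ℝ (Matrix (Fin n) (Fin n) ℝ) where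
  carrier := {A | A.IsSymm}
  add_mem' := fun ha hb => ha.add hb
  zero_mem' := Matrix.isSymm_zero
  smul_mem' := fun c _ ha => ha.smul c

/-- The linear space `𝕊ⁿ` of real symmetric `n × n` matrices. -/
def SymMat (n : ℕ) : Type := ↥(symSubmodule n)

namespace SymMat

variable {n : ℕ}

/-- The underlying matrix. -/
def mat (A : SymMat n) : Matrix (Fin n) (Fin n) ℝ := A.1

theorem isSymm (A : SymMat n) : A.mat.IsSymm := A.2

/-- A symmetric matrix, from a matrix and a proof of its symmetry. -/
def of (A : Matrix (Fin n) (Fin n) ℝ) (hA : A.IsSymm) : SymMat n := ⟨A, hA⟩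

theorem mat_of (A : Matrix (Fin n) (Fin n) ℝ) (hA : A.IsSymm) : (of A hA).mat = A := rfl

theorem ext {A B : SymMat n} (h : A.mat = B.mat) : A = B := Subtype.ext h

instance : AddCommGroup (SymMat n) := inferInstanceAs (AddCommGroup (symSubmodule n))

noncomputable instance : Module ℝ (SymMat n) := inferInstanceAs (Module ℝ (symSubmodule n))

instance : FiniteDimensional ℝ (SymMat n) :=
  inferInstanceAs (FiniteDimensional ℝ (symSubmodule n))

theorem mat_add (A B : SymMat n) : (A + B).mat = A.mat + B.mat := rfl
theorem mat_smul (c : ℝ) (A : SymMat n) : (c • A).mat = c • A.mat := rfl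
theorem mat_zero : (0 : SymMat n).mat = 0 := rfl
theorem mat_neg (A : SymMat n) : (-A).mat = -A.mat := rfl
theorem mat_sub (A B : SymMat n) : (A - B).mat = A.mat - B.mat := rfl

/-- The Frobenius inner product `⟨A, B⟩ = tr (Aᵀ B)`. -/
@[reducible]
noncomputable def core (n : ℕ) : InnerProductSpace.Core ℝ (SymMat n) where
  inner A B := (A.matᵀ * B.mat).trace
  conj_inner_symm A B := by
    simp only [conj_trivial]
    rw [← Matrix.trace_transpose, Matrix.transpose_mul, Matrix.transpose_transpose]
  re_inner_nonneg A := by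
    have h := (Matrix.posSemidef_conjTranspose_mul_self A.mat).trace_nonneg
    simpa [Matrix.conjTranspose_eq_transpose_of_trivial] using h
  add_left A B C := by
    simp [mat_add, Matrix.add_mul]
  smul_left A B r := by
    simp [mat_smul]
  definite A h := by
    apply ext
    rw [mat_zero]
    have h' : (A.matᴴ * A.mat).trace = 0 := by
      simpa [Matrix.conjTranspose_eq_transpose_of_trivial] using h
    exact Matrix.trace_conjTranspose_mul_self_eq_zero_iff.1 h'

/-- The Frobenius norm, and the topology that it induces. -/
noncomputable instance : NormedAddCommGroup (SymMat n) := (core n).toNormedAddCommGroup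

noncomputable instance : InnerProductSpace ℝ (SymMat n) := InnerProductSpace.ofCore (core n).toCore

theorem inner_def (A B : SymMat n) : ⟪A, B⟫ = (A.matᵀ * B.mat).trace := rfl

end SymMat

/-- The cone `𝕊ⁿ₊` of positive semidefinite matrices. -/
def psdCone (n : ℕ) : Set (SymMat n) := {A | A.mat.PosSemidef}

/-- The cone `𝕊ⁿ₋` of negative semidefinite matrices. -/
def nsdCone (n : ℕ) : Set (SymMat n) := {A | (-A.mat).PosSemidef}

/-! ### Variational analysis in a Euclidean space -/

section VariationalAnalysis

variable {E : Type*} [NormedAddCommGroup E] [InnerProductSpace ℝ E]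

open scoped Classical in
/-- The indicator function `δ_C` of a set. -/
noncomputable def indicatorFn (C : Set E) (x : E) : EReal := if x ∈ C then 0 else ⊤

/-- The Bouligand tangent (contingent) cone of `C` at `x`. -/
def tangentCone (C : Set E) (x : E) : Set E :=
  {d | ∃ (t : ℕ → ℝ) (u : ℕ → E), (∀ k, 0 < t k) ∧ Tendsto t atTop (𝓝 0) ∧
    Tendsto u atTop (𝓝 d) ∧ ∀ k, x + t k • u k ∈ C}

/-- The critical cone `𝒯_C(x) ∩ y^⊥`. -/
def criticalCone (C : Set E) (x y : E) : Set E :=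
  tangentCone C x ∩ {d | ⟪y, d⟫ = 0}

/-- The proximal subdifferential; it is empty where `f` is not finite. -/
def proximalSubdiff (f : E → EReal) (x : E) : Set E :=
  {d | f x ≠ ⊤ ∧ f x ≠ ⊥ ∧ ∃ l > (0 : ℝ), ∃ r > (0 : ℝ), ∀ y ∈ Metric.ball x r,
    f x + ((⟪d, y - x⟫ - l * ‖y - x‖ ^ 2 : ℝ) : EReal) ≤ f y}

/-- The limiting (Mordukhovich) subdifferential; it is empty where `f` is not finite. -/
def subdiff (f : E → EReal) (x : E) : Set E :=
  {d | f x ≠ ⊤ ∧ f x ≠ ⊥ ∧ ∃ (u v : ℕ → E), Tendsto u atTop (𝓝 x) ∧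
    Tendsto (fun k => f (u k)) atTop (𝓝 (f x)) ∧ Tendsto v atTop (𝓝 d) ∧
    ∀ k, v k ∈ proximalSubdiff f (u k)}

/-- Epi-convergence of `f i` to `g` along the filter `l`: the lower limit of `f i y` as `i` runs
along `l` and `y → x` is at least `g x`, and some family `u i → x` has
`limsup f i (u i) ≤ g x`. -/
def EpiConverges {ι : Type*} (l : Filter ι) (f : ι → E → EReal) (g : E → EReal) : Prop :=
  ∀ x : E, g x ≤ liminf (fun p : ι × E => f p.1 p.2) (l ×ˢ 𝓝 x) ∧
    ∃ u : ι → E, Tendsto u l (𝓝 x) ∧ limsup (fun i => f i (u i)) l ≤ g x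

/-- The second-order difference quotient
`(f (x + t u) - f x - t ⟨v, u⟩) / (t² / 2)`. -/
noncomputable def secondDiffQuot (f : E → EReal) (x v : E) (t : ℝ) (u : E) : EReal :=
  (f (x + t • u) - f x - ((t * ⟪v, u⟫ : ℝ) : EReal)) / ((t ^ 2 / 2 : ℝ) : EReal)

/-- The second subderivative `d²f(x | v)`. -/
noncomputable def secondSubderiv (f : E → EReal) (x v : E) (w : E) : EReal :=
  liminf (fun p : ℝ × E => secondDiffQuot f x v p.1 p.2) (𝓝[>] 0 ×ˢ 𝓝 w)

/-- `f` is twice epi-differentiable at `x` for `v`. -/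
def TwiceEpiDifferentiableAt (f : E → EReal) (x v : E) : Prop :=
  f x ≠ ⊤ ∧ f x ≠ ⊥ ∧
    EpiConverges (𝓝[>] (0 : ℝ)) (fun t => secondDiffQuot f x v t) (secondSubderiv f x v)

/-- A set-valued mapping is generalized linear if its graph is a linear subspace. -/
def IsGeneralizedLinear (R : E → Set E) : Prop :=
  ∃ S : Submodule ℝ (E × E), ∀ x y, (x, y) ∈ S ↔ y ∈ R x

/-- A generalized quadratic form: a function into `(-∞, ∞]` that vanishes at `0` and whose
subgradient mapping is generalized linear. -/
def IsGeneralizedQuadraticForm (q : E → EReal) : Prop :=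
  (∀ x, q x ≠ ⊥) ∧ q 0 = 0 ∧ IsGeneralizedLinear (subdiff q)

/-- `f` is generalized twice differentiable at `x` for the subgradient `y`. -/
def GeneralizedTwiceDifferentiableAt (f : E → EReal) (x y : E) : Prop :=
  y ∈ subdiff f x ∧ TwiceEpiDifferentiableAt f x y ∧
    IsGeneralizedQuadraticForm (secondSubderiv f x y)

/-- The quadratic bundle `quad θ(x | y)`. -/
def quadBundle (θ : E → EReal) (x y : E) : Set (E → EReal) :=
  {q | IsGeneralizedQuadraticForm q ∧
    ∃ (u v : ℕ → E), Tendsto u atTop (𝓝 x) ∧ Tendsto v atTop (𝓝 y) ∧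
      (∀ k, GeneralizedTwiceDifferentiableAt θ (u k) (v k)) ∧
      EpiConverges atTop
        (fun k H => ((1 / 2 : ℝ) : EReal) * secondSubderiv θ (u k) (v k) H) q}

end VariationalAnalysis

/-! ### The generalized inverse and the `σ`-term -/

/-- The four Penrose equations: `B` is the Moore–Penrose inverse of the real matrix `A`. -/
structure IsMoorePenroseInverse {n : ℕ} (A B : Matrix (Fin n) (Fin n) ℝ) : Prop where
  mul_mul_left : A * B * A = A
  mul_mul_right : B * A * B = B
  symm_left : (A * B).IsSymm
  symm_right : (B * A).IsSymm

theorem exists_isMoorePenroseInverse {n : ℕ} (A : SymMat n) :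
    ∃ B, IsMoorePenroseInverse A.mat B := by
  have hA : A.mat.IsHermitian := by
    rw [Matrix.IsHermitian, Matrix.conjTranspose_eq_transpose_of_trivial]
    exact A.isSymm
  obtain ⟨U, d, hU, hd⟩ : ∃ (U : Matrix (Fin n) (Fin n) ℝ) (d : Fin n → ℝ),
      Uᵀ * U = 1 ∧ A.mat = U * Matrix.diagonal d * Uᵀ := by
    refine ⟨hA.eigenvectorUnitary, hA.eigenvalues, ?_, ?_⟩
    · have := Unitary.coe_star_mul_self hA.eigenvectorUnitary
      rwa [Matrix.star_eq_conjTranspose, Matrix.conjTranspose_eq_transpose_of_trivial] at this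
    · have := hA.spectral_theorem
      rw [Unitary.conjStarAlgAut_apply, Matrix.star_eq_conjTranspose,
        Matrix.conjTranspose_eq_transpose_of_trivial] at this
      exact this
  have key : ∀ a b : Fin n → ℝ, U * Matrix.diagonal a * Uᵀ * (U * Matrix.diagonal b * Uᵀ) =
      U * Matrix.diagonal (a * b) * Uᵀ := by
    intro a b
    calc U * Matrix.diagonal a * Uᵀ * (U * Matrix.diagonal b * Uᵀ)
        = U * Matrix.diagonal a * (Uᵀ * U) * Matrix.diagonal b * Uᵀ := by
          simp only [Matrix.mul_assoc]
      _ = U * (Matrix.diagonal a * Matrix.diagonal b) * Uᵀ := by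
          rw [hU]
          simp only [Matrix.mul_assoc, Matrix.one_mul]
      _ = _ := by
          rw [Matrix.diagonal_mul_diagonal]
          rfl
  have symm : ∀ a : Fin n → ℝ, (U * Matrix.diagonal a * Uᵀ).IsSymm := by
    intro a
    simp [Matrix.IsSymm, Matrix.transpose_mul, Matrix.mul_assoc]
  refine ⟨U * Matrix.diagonal d⁻¹ * Uᵀ, ?_, ?_, ?_, ?_⟩
  · rw [hd, key, key]
    congr 3
    ext i
    simp
  · rw [hd, key, key]
    congr 3
    ext i
    by_cases h : d i = 0 <;> simp [h]
  · rw [hd, key]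
    exact symm _
  · rw [hd, key]
    exact symm _

/-- The generalized (Moore–Penrose) inverse `A†`. -/
noncomputable def pinv {n : ℕ} (A : SymMat n) : Matrix (Fin n) (Fin n) ℝ :=
  (exists_isMoorePenroseInverse A).choose

theorem pinv_spec {n : ℕ} (A : SymMat n) : IsMoorePenroseInverse A.mat (pinv A) :=
  (exists_isMoorePenroseInverse A).choose_spec

/-- The `σ`-term `Υ_X(Y, H) = 2 ⟨Y, H X† H⟩`, with the Frobenius inner product. -/
noncomputable def sigmaTerm {n : ℕ} (X Y H : SymMat n) : ℝ :=
  2 * (Y.matᵀ * (H.mat * pinv X * H.mat)).trace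

/-! ### Nonlinear semidefinite programming -/

/-- The Lagrangian `L(x, Y) = f(x) + ⟨Y, G(x)⟩`. -/
noncomputable def lagrangian {X : Type*} {n : ℕ} (f : X → ℝ) (G : X → SymMat n)
    (x : X) (Y : SymMat n) : ℝ :=
  f x + ⟪Y, G x⟫

/-- `(x, Y)` is a KKT pair of `min f(x)` subject to `G(x) ∈ 𝕊ⁿ₊`; that is, `x` is a stationary
point and `Y` is a multiplier at `x`. -/
def IsKKTPair {X : Type*} [NormedAddCommGroup X] [InnerProductSpace ℝ X] {n : ℕ}
    (f : X → ℝ) (G : X → SymMat n) (x : X) (Y : SymMat n) : Prop :=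
  fderiv ℝ (fun z => lagrangian f G z Y) x = 0 ∧
    G x ∈ psdCone n ∧ Y ∈ nsdCone n ∧ ⟪G x, Y⟫ = 0

/-- `A = P Λ Pᵀ` with `P` orthogonal and `Λ = Diag(lam)`, the eigenvalues being listed in
nonincreasing order. -/
def IsOrderedEigendecomposition {n : ℕ} (A : SymMat n) (P : Matrix (Fin n) (Fin n) ℝ)
    (lam : Fin n → ℝ) : Prop :=
  P ∈ Matrix.orthogonalGroup (Fin n) ℝ ∧ Antitone lam ∧ A.mat = P * Matrix.diagonal lam * Pᵀ

end NLSDP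

open NLSDP

/-!
A KKT pair `(X, Y)`, with `X = G x`, consists of complementary matrices, so that `X Y = 0`, and an
orthogonal `P` that diagonalizes `X + Y` diagonalizes both: `X = P Diag(a) Pᵀ` and
`Y = -P Diag(b) Pᵀ`, with `a, b ≥ 0` the positive and negative parts of the eigenvalues
(`eq_diagSym_of_complementary`). In the coordinates `T = Pᵀ H P` the required form is `quadFn P a b`,
that is, `∑ (b j / a i) T i j ^ 2` restricted to the subspace `critSub P a b` of the `H` with
`T i j = 0` whenever `a i = 0` and `b j ≠ 0`. This subspace is the affine hull of the critical
cone (`affineSpan_criticalCone`), and the sum is `-1/2` times the `σ`-term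
(`neg_half_sigmaTerm_diagSym`).

If `a` and `b` have no common zero (strict complementarity), half the second subderivative of the
indicator function of `𝕊ⁿ₊` at `X` for `Y` is `quadFn P a b`, and the difference quotients
epi-converge (`epiConverges_secondDiffQuot_psdCone`). The lower bound comes from evaluating the
matrix `Diag(a) + t Pᵀ u P`, which is positive semidefinite for a feasible direction `u` near `H`,
at the vector `e_j - t h`, `h i = T i j / a i`, for each `j` with `a j = 0`. It is attained along the arc `(1 + t K) Diag(a) (1 + t K)ᵀ`, with `K`
chosen so that the arc has the prescribed derivative. The limit is a quadratic form restricted to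
a subspace, hence a generalized quadratic form, since `y` is a subgradient of such a function at a
point of the subspace iff it agrees there with the gradient of the form
(`mem_subdiff_bilin_add_indicatorFn_iff`).

In general, let `Y` be fixed and replace by `1 / (k + 1)` each `a i` for which `a i = b i = 0`.
The resulting pairs are strictly complementary and converge to `(X, Y)`. Their forms epi-converge
to `quadFn P a b`: the coefficients `(k + 1) b j` of the entries `(i, j)` with `a i = b i = 0`
tend to infinity and force these entries to vanish (`epiConverges_quadFn_perturb`).
-/

namespace NLSDP

/-! ### Lower limits and epi-convergence -/

theorem le_liminf_of_tendsto_of_le {ι : Type*} {l : Filter ι} [l.NeBot] {f F : ι → EReal}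
    {c : EReal} (hf : Tendsto f l (𝓝 c)) (hle : ∀ᶠ p in l, f p ≤ F p) : c ≤ liminf F l := by
  rw [← hf.liminf_eq]
  exact liminf_le_liminf hle

/-- An epi-limit is the lower limit that enters its definition. -/
theorem EpiConverges.eq_liminf {E : Type*} [NormedAddCommGroup E] {ι : Type*}
    {l : Filter ι} [l.NeBot] {f : ι → E → EReal} {g : E → EReal}
    (h : EpiConverges l f g) (w : E) :
    liminf (fun p : ι × E => f p.1 p.2) (l ×ˢ 𝓝 w) = g w := by
  obtain ⟨hlow, u, hu, hup⟩ := h w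
  refine le_antisymm (le_trans ?_ hup) hlow
  have hmap : map (fun i => (i, u i)) l ≤ l ×ˢ 𝓝 w := tendsto_id.prodMk hu
  calc liminf (fun p : ι × E => f p.1 p.2) (l ×ˢ 𝓝 w)
      ≤ liminf (fun p : ι × E => f p.1 p.2) (map (fun i => (i, u i)) l) :=
        liminf_le_liminf_of_le hmap
    _ = liminf (fun i => f i (u i)) l := rfl
    _ ≤ limsup (fun i => f i (u i)) l := liminf_le_limsup

/-! ### Indicator functions -/

theorem indicatorFn_of_mem {α : Type*} {C : Set α} {x : α} (h : x ∈ C) :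
    indicatorFn C x = 0 := if_pos h

theorem indicatorFn_of_notMem {α : Type*} {C : Set α} {x : α} (h : x ∉ C) :
    indicatorFn C x = ⊤ := if_neg h

theorem add_indicatorFn_of_mem {α : Type*} {C : Set α} {x : α} (h : x ∈ C) (r : ℝ) :
    (r : EReal) + indicatorFn C x = r := by
  rw [indicatorFn_of_mem h, add_zero]

theorem add_indicatorFn_of_notMem {α : Type*} {C : Set α} {x : α} (h : x ∉ C) (r : ℝ) :
    (r : EReal) + indicatorFn C x = ⊤ := by
  rw [indicatorFn_of_notMem h, EReal.coe_add_top]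

section Variational

variable {E : Type*} [NormedAddCommGroup E] [InnerProductSpace ℝ E]

/-! ### Quadratic forms restricted to a subspace -/

theorem mem_proximalSubdiff_bilin_add_indicatorFn_iff (B : E →L[ℝ] E →L[ℝ] ℝ)
    (hB : ∀ x y, B x y = B y x) (S : Submodule ℝ E) (x d : E) :
    d ∈ proximalSubdiff (fun z => ((B z z : ℝ) : EReal) + indicatorFn (S : Set E) z) x ↔
      x ∈ S ∧ ∀ s ∈ S, ⟪d, s⟫ = 2 * B x s := by
  constructor
  · rintro ⟨htop, -, l, -, r, hr, h⟩
    have hx : x ∈ S := by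
      by_contra hx
      exact htop (add_indicatorFn_of_notMem hx _)
    -- The subgradient inequality at `x + τ s`, divided by `τ`, in the limit `τ ↓ 0`.
    have hle : ∀ s ∈ S, ⟪d, s⟫ - 2 * B x s ≤ 0 := by
      intro s hs
      have hlim : Tendsto (fun τ : ℝ => τ * (B s s + l * ‖s‖ ^ 2)) (𝓝[>] 0) (𝓝 0) := by
        have : Continuous (fun τ : ℝ => τ * (B s s + l * ‖s‖ ^ 2)) := by fun_prop
        simpa using (this.tendsto 0).mono_left nhdsWithin_le_nhds
      refine ge_of_tendsto hlim ?_
      have hball : ∀ᶠ τ in 𝓝[>] (0 : ℝ), x + τ • s ∈ Metric.ball x r := by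
        have hc : Continuous (fun τ : ℝ => x + τ • s) := by fun_prop
        have := (hc.tendsto 0).mono_left (nhdsWithin_le_nhds (s := Set.Ioi 0))
        rw [zero_smul, add_zero] at this
        exact this (Metric.ball_mem_nhds x hr)
      filter_upwards [hball, self_mem_nhdsWithin] with τ hτ hpos
      have hpos : 0 < τ := hpos
      have := h _ hτ
      beta_reduce at this
      rw [add_indicatorFn_of_mem (C := (S : Set E)) hx,
        add_indicatorFn_of_mem (C := (S : Set E)) (S.add_mem hx (S.smul_mem τ hs)),
        ← EReal.coe_add, EReal.coe_le_coe_iff, add_sub_cancel_left, inner_smul_right,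
        norm_smul, Real.norm_of_nonneg hpos.le] at this
      simp only [map_add, map_smul, add_apply, smul_apply, smul_eq_mul, hB s x] at this
      have key : τ * (⟪d, s⟫ - 2 * B x s) ≤ τ * (τ * (B s s + l * ‖s‖ ^ 2)) := by
        nlinarith [this]
      exact le_of_mul_le_mul_left key hpos
    refine ⟨hx, fun s hs => le_antisymm (by linarith [hle s hs]) ?_⟩
    have := hle (-s) (S.neg_mem hs)
    rw [inner_neg_right, map_neg] at this
    linarith
  · rintro ⟨hx, hd⟩
    refine ⟨?_, ?_, ‖B‖ + 1, by positivity, 1, one_pos, fun z _ => ?_⟩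
    · beta_reduce
      rw [add_indicatorFn_of_mem (C := (S : Set E)) hx]
      exact EReal.coe_ne_top _
    · beta_reduce
      rw [add_indicatorFn_of_mem (C := (S : Set E)) hx]
      exact EReal.coe_ne_bot _
    by_cases hz : z ∈ S
    · beta_reduce
      rw [add_indicatorFn_of_mem (C := (S : Set E)) hx,
        add_indicatorFn_of_mem (C := (S : Set E)) hz, ← EReal.coe_add, EReal.coe_le_coe_iff,
        hd _ (S.sub_mem hz hx)]
      have hbd : -(‖B‖ * ‖z - x‖ ^ 2) ≤ B (z - x) (z - x) := by
        have := B.le_opNorm₂ (z - x) (z - x)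
        rw [Real.norm_eq_abs] at this
        have := (abs_le.1 this).1
        nlinarith
      have hexp : B z z = B x x + 2 * B x (z - x) + B (z - x) (z - x) := by
        simp only [map_sub, sub_apply, hB z x]
        ring
      rw [hexp]
      nlinarith [sq_nonneg ‖z - x‖]
    · beta_reduce
      rw [add_indicatorFn_of_notMem (C := (S : Set E)) hz]
      exact le_top

/-- The subgradients at `x ∈ S` of a quadratic form restricted to a subspace `S` are the vectors
that agree on `S` with the gradient of the form. -/
theorem mem_subdiff_bilin_add_indicatorFn_iff (B : E →L[ℝ] E →L[ℝ] ℝ)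
    (hB : ∀ x y, B x y = B y x) (S : Submodule ℝ E) (x d : E) :
    d ∈ subdiff (fun z => ((B z z : ℝ) : EReal) + indicatorFn (S : Set E) z) x ↔
      x ∈ S ∧ ∀ s ∈ S, ⟪d, s⟫ = 2 * B x s := by
  constructor
  · rintro ⟨htop, -, u, v, hu, -, hv, hmem⟩
    refine ⟨?_, fun s hs => ?_⟩
    · by_contra hx
      exact htop (add_indicatorFn_of_notMem hx _)
    have h1 : Tendsto (fun k => ⟪v k, s⟫) atTop (𝓝 ⟪d, s⟫) := hv.inner tendsto_const_nhds
    have hc : Continuous (fun z => 2 * B z s) := by fun_prop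
    have h2 := (hc.tendsto x).comp hu
    refine tendsto_nhds_unique (h1.congr fun k => ?_) h2
    exact ((mem_proximalSubdiff_bilin_add_indicatorFn_iff B hB S _ _).1 (hmem k)).2 s hs
  · intro h
    have hp := (mem_proximalSubdiff_bilin_add_indicatorFn_iff B hB S x d).2 h
    exact ⟨hp.1, hp.2.1, fun _ => x, fun _ => d, tendsto_const_nhds, tendsto_const_nhds,
      tendsto_const_nhds, fun _ => hp⟩

theorem isGeneralizedQuadraticForm_bilin_add_indicatorFn (B : E →L[ℝ] E →L[ℝ] ℝ)
    (hB : ∀ x y, B x y = B y x) (S : Submodule ℝ E) :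
    IsGeneralizedQuadraticForm
      (fun z => ((B z z : ℝ) : EReal) + indicatorFn (S : Set E) z) := by
  refine ⟨fun x => ?_, ?_, ?_⟩
  · by_cases hx : x ∈ (S : Set E)
    · beta_reduce
      rw [add_indicatorFn_of_mem hx]
      exact EReal.coe_ne_bot _
    · beta_reduce
      rw [add_indicatorFn_of_notMem hx]
      exact top_ne_bot
  · beta_reduce
    rw [add_indicatorFn_of_mem (C := (S : Set E)) S.zero_mem]
    simp
  · refine ⟨
      { carrier := {p | p.1 ∈ S ∧ ∀ s ∈ S, ⟪p.2, s⟫ = 2 * B p.1 s}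
        add_mem' := ?_
        zero_mem' := ?_
        smul_mem' := ?_ }, fun x y =>
      (mem_subdiff_bilin_add_indicatorFn_iff B hB S x y).symm⟩
    · rintro p q ⟨hp, hp'⟩ ⟨hq, hq'⟩
      refine ⟨S.add_mem hp hq, fun s hs => ?_⟩
      simp only [Prod.snd_add, Prod.fst_add, inner_add_left, map_add, add_apply, hp' s hs,
        hq' s hs]
      ring
    · exact ⟨S.zero_mem, fun s _ => by simp⟩
    · rintro c p ⟨hp, hp'⟩
      refine ⟨S.smul_mem c hp, fun s hs => ?_⟩
      simp only [Prod.smul_snd, Prod.smul_fst, real_inner_smul_left, map_smul, smul_apply,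
        smul_eq_mul, hp' s hs]
      ring

/-! ### Second-order difference quotients of an indicator function -/

theorem secondDiffQuot_indicatorFn_of_mem {C : Set E} {x v u : E} {t : ℝ} (hx : x ∈ C)
    (hu : x + t • u ∈ C) :
    secondDiffQuot (indicatorFn C) x v t u = ((-(t * ⟪v, u⟫) / (t ^ 2 / 2) : ℝ) : EReal) := by
  rw [secondDiffQuot, indicatorFn_of_mem hx, indicatorFn_of_mem hu, sub_zero, zero_sub,
    ← EReal.coe_neg, ← EReal.coe_div]

theorem secondDiffQuot_indicatorFn_of_notMem {C : Set E} {x v u : E} {t : ℝ} (ht : 0 < t)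
    (hx : x ∈ C) (hu : x + t • u ∉ C) :
    secondDiffQuot (indicatorFn C) x v t u = ⊤ := by
  rw [secondDiffQuot, indicatorFn_of_mem hx, indicatorFn_of_notMem hu, sub_zero,
    EReal.top_sub_coe, EReal.top_div_of_pos_ne_top]
  · exact_mod_cast (by positivity : 0 < t ^ 2 / 2)
  · exact EReal.coe_ne_top _

/-- A vector `y` with `⟪y, z - x⟫ ≤ 0` for all `z ∈ C` is a subgradient of the indicator function
of `C` at `x`. -/
theorem mem_subdiff_indicatorFn {C : Set E} {x y : E} (hx : x ∈ C)
    (h : ∀ z ∈ C, ⟪y, z - x⟫ ≤ 0) : y ∈ subdiff (indicatorFn C) x := by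
  have hx0 := indicatorFn_of_mem hx
  have hp : y ∈ proximalSubdiff (indicatorFn C) x := by
    refine ⟨by simp [hx0], by simp [hx0], 1, one_pos, 1, one_pos, fun z _ => ?_⟩
    by_cases hz : z ∈ C
    · rw [hx0, indicatorFn_of_mem hz, zero_add]
      have : ⟪y, z - x⟫ - 1 * ‖z - x‖ ^ 2 ≤ 0 := by
        nlinarith [h z hz, sq_nonneg ‖z - x‖]
      exact_mod_cast this
    · rw [indicatorFn_of_notMem hz]
      exact le_top
  exact ⟨hp.1, hp.2.1, fun _ => x, fun _ => y, tendsto_const_nhds, tendsto_const_nhds,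
    tendsto_const_nhds, fun _ => hp⟩

end Variational

variable {n : ℕ}

/-! ### Positive semidefinite matrices -/

theorem isSymm_of_posSemidef {M : Matrix (Fin n) (Fin n) ℝ} (hM : M.PosSemidef) :
    M.IsSymm := by
  have := hM.isHermitian.eq
  rwa [Matrix.conjTranspose_eq_transpose_of_trivial] at this

theorem posSemidef_entries_nonneg {M : Matrix (Fin n) (Fin n) ℝ} (hM : M.PosSemidef)
    (r s : ℝ) (i j : Fin n) :
    0 ≤ r ^ 2 * M i i + 2 * (r * s) * M i j + s ^ 2 * M j j := by
  have h := hM.dotProduct_mulVec_nonneg (r • Pi.single i 1 + s • Pi.single j 1)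
  have hsymm : M j i = M i j := by simpa using hM.isHermitian.apply i j
  simp only [star_trivial, Matrix.mulVec_add, Matrix.mulVec_smul, add_dotProduct,
    dotProduct_add, smul_dotProduct, dotProduct_smul, Matrix.mulVec_single_one,
    single_one_dotProduct, Matrix.col_apply, smul_eq_mul, hsymm] at h
  nlinarith

theorem two_mul_abs_le_of_posSemidef {M : Matrix (Fin n) (Fin n) ℝ} (hM : M.PosSemidef)
    (i j : Fin n) : 2 * |M i j| ≤ M i i + M j j := by
  have h1 := posSemidef_entries_nonneg hM 1 1 i j
  have h2 := posSemidef_entries_nonneg hM 1 (-1) i j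
  rcases abs_cases (M i j) with ⟨h, -⟩ | ⟨h, -⟩ <;> rw [h] <;> linarith

open scoped MatrixOrder Matrix.Norms.L2Operator in
theorem mul_eq_zero_of_posSemidef_of_trace_mul_eq_zero {A B : Matrix (Fin n) (Fin n) ℝ}
    (hA : A.PosSemidef) (hB : B.PosSemidef) (h : (A * B).trace = 0) : A * B = 0 := by
  obtain ⟨R, rfl⟩ := CStarAlgebra.nonneg_iff_eq_star_mul_self.1 hA.nonneg
  obtain ⟨T, rfl⟩ := CStarAlgebra.nonneg_iff_eq_star_mul_self.1 hB.nonneg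
  simp only [Matrix.star_eq_conjTranspose] at h ⊢
  -- `tr (Rᴴ R Tᴴ T)` is the squared Frobenius norm of `T Rᴴ`.
  have h0 : T * Rᴴ = 0 := by
    rw [← Matrix.trace_conjTranspose_mul_self_eq_zero_iff, ← h, Matrix.conjTranspose_mul,
      Matrix.conjTranspose_conjTranspose]
    calc (R * Tᴴ * (T * Rᴴ)).trace = ((R * (Tᴴ * T)) * Rᴴ).trace := by
          simp only [Matrix.mul_assoc]
      _ = (Rᴴ * R * (Tᴴ * T)).trace := by
          rw [Matrix.trace_mul_comm, Matrix.mul_assoc]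
  have h1 : R * Tᴴ = 0 := by simpa using congrArg Matrix.conjTranspose h0
  rw [Matrix.mul_assoc, ← Matrix.mul_assoc R, h1, Matrix.zero_mul, Matrix.mul_zero]

theorem diagonal_add_smul_apply {a : Fin n → ℝ} (N : Matrix (Fin n) (Fin n) ℝ) (t : ℝ)
    {i : Fin n} (hi : a i = 0) (j : Fin n) : (Matrix.diagonal a + t • N) i j = t * N i j := by
  by_cases hij : i = j
  · subst hij
    simp [hi]
  · simp [hij]

/-- The test vector `e_j - t h` in the quadratic form of `Diag a + t N`, for an index `j` with
`a j = 0`; after division by `t`, the terms of order zero and one cancel. -/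
theorem posSemidef_diagonal_add_smul_test {a : Fin n → ℝ} {N : Matrix (Fin n) (Fin n) ℝ}
    (hN : N.IsSymm) {t : ℝ} (ht : 0 < t) (hM : (Matrix.diagonal a + t • N).PosSemidef)
    {j : Fin n} (hj : a j = 0) (h : Fin n → ℝ) :
    0 ≤ N j j - 2 * t * ∑ i, N i j * h i + t * ∑ i, a i * h i ^ 2 +
      t ^ 2 * ∑ i, ∑ k, h i * N i k * h k := by
  have key := hM.dotProduct_mulVec_nonneg (Pi.single j 1 - t • h)
  have e1 : h ⬝ᵥ N.col j = ∑ i, N i j * h i := by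
    simp [dotProduct, mul_comm]
  have e2 : (N *ᵥ h) j = ∑ i, N i j * h i := by
    simp only [Matrix.mulVec, dotProduct]
    exact sum_congr rfl fun i _ => by rw [hN.apply]
  have e3 : h ⬝ᵥ (N *ᵥ h) = ∑ i, ∑ k, h i * N i k * h k := by
    simp only [Matrix.mulVec, dotProduct, mul_sum, mul_assoc]
  have e4 : h ⬝ᵥ (Matrix.diagonal a *ᵥ h) = ∑ i, a i * h i ^ 2 := by
    simp only [Matrix.mulVec_diagonal, dotProduct]
    exact sum_congr rfl fun i _ => by ring
  have e5 : (Matrix.diagonal a + t • N).col j = t • N.col j := by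
    ext i
    by_cases hij : i = j
    · subst hij
      simp [hj]
    · simp [hij]
  have e6 : (Matrix.diagonal a *ᵥ h) j = 0 := by simp [Matrix.mulVec_diagonal, hj]
  simp only [star_trivial, Matrix.mulVec_sub, Matrix.mulVec_smul, Matrix.add_mulVec,
    Matrix.smul_mulVec, sub_dotProduct, dotProduct_sub, dotProduct_add, smul_dotProduct,
    dotProduct_smul, Matrix.mulVec_single_one, single_one_dotProduct, Matrix.col_apply,
    smul_eq_mul, e1, e2, e3, e4, e5, e6] at key
  refine le_of_mul_le_mul_left ?_ ht
  rw [mul_zero]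
  refine key.trans_eq ?_
  ring

/-! ### Coordinates with respect to an orthogonal matrix -/

/-- The matrix `Pᵀ H P` of `H` in the orthonormal basis formed by the columns of `P`. -/
def coord (P : Matrix (Fin n) (Fin n) ℝ) (H : SymMat n) : Matrix (Fin n) (Fin n) ℝ :=
  Pᵀ * H.mat * P

theorem coord_add (P : Matrix (Fin n) (Fin n) ℝ) (A B : SymMat n) :
    coord P (A + B) = coord P A + coord P B := by
  simp [coord, SymMat.mat_add, Matrix.mul_add, Matrix.add_mul]

theorem coord_sub (P : Matrix (Fin n) (Fin n) ℝ) (A B : SymMat n) :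
    coord P (A - B) = coord P A - coord P B := by
  simp [coord, SymMat.mat_sub, Matrix.mul_sub, Matrix.sub_mul]

theorem coord_smul (P : Matrix (Fin n) (Fin n) ℝ) (c : ℝ) (A : SymMat n) :
    coord P (c • A) = c • coord P A := by
  simp [coord, SymMat.mat_smul]

theorem coord_zero (P : Matrix (Fin n) (Fin n) ℝ) : coord P 0 = 0 := by
  simp [coord, SymMat.mat_zero]

theorem coord_isSymm (P : Matrix (Fin n) (Fin n) ℝ) (A : SymMat n) : (coord P A).IsSymm := by
  have := A.isSymm
  rw [Matrix.IsSymm] at this ⊢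
  simp [coord, Matrix.transpose_mul, this, Matrix.mul_assoc]

/-- An entry of `Pᵀ H P` as a continuous linear functional of `H`. -/
noncomputable def coordCLM (P : Matrix (Fin n) (Fin n) ℝ) (i j : Fin n) : SymMat n →L[ℝ] ℝ :=
  LinearMap.toContinuousLinearMap
    { toFun := fun H => coord P H i j
      map_add' := fun A B => by rw [coord_add]; rfl
      map_smul' := fun c A => by rw [coord_smul]; rfl }

theorem coordCLM_apply (P : Matrix (Fin n) (Fin n) ℝ) (i j : Fin n) (H : SymMat n) :
    coordCLM P i j H = coord P H i j := rfl

@[fun_prop]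
theorem continuous_coord_apply (P : Matrix (Fin n) (Fin n) ℝ) (i j : Fin n) :
    Continuous fun H : SymMat n => coord P H i j :=
  (coordCLM P i j).continuous

/-- The symmetric matrix `P M Pᵀ`, whose coordinates are `M` if `P` is orthogonal. -/
def ofCoord (P M : Matrix (Fin n) (Fin n) ℝ) (hM : M.IsSymm) : SymMat n :=
  SymMat.of (P * M * Pᵀ) (by
    rw [Matrix.IsSymm] at hM ⊢
    simp [Matrix.transpose_mul, hM, Matrix.mul_assoc])

theorem coord_ofCoord {P : Matrix (Fin n) (Fin n) ℝ} (hP : Pᵀ * P = 1)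
    (M : Matrix (Fin n) (Fin n) ℝ) (hM : M.IsSymm) : coord P (ofCoord P M hM) = M := by
  rw [coord, ofCoord, SymMat.mat_of]
  calc Pᵀ * (P * M * Pᵀ) * P = (Pᵀ * P) * M * (Pᵀ * P) := by simp only [Matrix.mul_assoc]
    _ = M := by rw [hP, Matrix.one_mul, Matrix.mul_one]

theorem mul_coord_mul_transpose {P : Matrix (Fin n) (Fin n) ℝ} (hP : Pᵀ * P = 1)
    (H : SymMat n) : P * coord P H * Pᵀ = H.mat := by
  have hP' : P * Pᵀ = 1 := mul_eq_one_comm.1 hP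
  rw [coord]
  calc P * (Pᵀ * H.mat * P) * Pᵀ = (P * Pᵀ) * H.mat * (P * Pᵀ) := by
        simp only [Matrix.mul_assoc]
    _ = H.mat := by rw [hP', Matrix.one_mul, Matrix.mul_one]

theorem coord_injective {P : Matrix (Fin n) (Fin n) ℝ} (hP : Pᵀ * P = 1) :
    Function.Injective (coord P) := fun A B h => by
  apply SymMat.ext
  rw [← mul_coord_mul_transpose hP A, h, mul_coord_mul_transpose hP B]

theorem posSemidef_coord_of_mem {H : SymMat n} (P : Matrix (Fin n) (Fin n) ℝ)
    (h : H ∈ psdCone n) : (coord P H).PosSemidef := by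
  have := Matrix.PosSemidef.conjTranspose_mul_mul_same (show H.mat.PosSemidef from h) P
  rwa [Matrix.conjTranspose_eq_transpose_of_trivial] at this

theorem mem_psdCone_of_coord {P : Matrix (Fin n) (Fin n) ℝ} (hP : Pᵀ * P = 1) {H : SymMat n}
    (h : (coord P H).PosSemidef) : H ∈ psdCone n := by
  have := h.mul_mul_conjTranspose_same P
  rwa [Matrix.conjTranspose_eq_transpose_of_trivial, mul_coord_mul_transpose hP] at this

theorem inner_eq_trace_coord {P : Matrix (Fin n) (Fin n) ℝ} (hP : Pᵀ * P = 1)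
    (A B : SymMat n) : ⟪A, B⟫ = (coord P A * coord P B).trace := by
  have hP' : P * Pᵀ = 1 := mul_eq_one_comm.1 hP
  have hA : A.matᵀ = A.mat := A.isSymm
  rw [SymMat.inner_def, hA, coord, coord]
  calc (A.mat * B.mat).trace = (A.mat * (P * Pᵀ) * B.mat * (P * Pᵀ)).trace := by
        rw [hP', Matrix.mul_one, Matrix.mul_one]
    _ = ((A.mat * P * Pᵀ * B.mat * P) * Pᵀ).trace := by simp only [Matrix.mul_assoc]
    _ = _ := by
        rw [Matrix.trace_mul_comm]
        simp only [Matrix.mul_assoc]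

/-- The symmetric matrix `P Diag(d) Pᵀ`. -/
def diagSym (P : Matrix (Fin n) (Fin n) ℝ) (d : Fin n → ℝ) : SymMat n :=
  ofCoord P (Matrix.diagonal d) (Matrix.isSymm_diagonal d)

theorem coord_diagSym {P : Matrix (Fin n) (Fin n) ℝ} (hP : Pᵀ * P = 1) (d : Fin n → ℝ) :
    coord P (diagSym P d) = Matrix.diagonal d :=
  coord_ofCoord hP _ _

theorem inner_diagSym {P : Matrix (Fin n) (Fin n) ℝ} (hP : Pᵀ * P = 1) (d : Fin n → ℝ)
    (H : SymMat n) : ⟪diagSym P d, H⟫ = ∑ i, d i * coord P H i i := by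
  rw [inner_eq_trace_coord hP, coord_diagSym hP]
  simp [Matrix.trace]

theorem diagSym_mem_psdCone {P : Matrix (Fin n) (Fin n) ℝ} (hP : Pᵀ * P = 1) {d : Fin n → ℝ}
    (hd : ∀ i, 0 ≤ d i) : diagSym P d ∈ psdCone n := by
  refine mem_psdCone_of_coord hP ?_
  rw [coord_diagSym hP]
  exact Matrix.posSemidef_diagonal_iff.2 hd

/-! ### Second-order feasible arcs -/

/-- The factor `K` of the arc `(1 + t K) Diag(a) (1 + t K)ᵀ`, which is positive semidefinite and
has derivative `N` at `t = 0` whenever `N` vanishes on the block of the zeros of `a`. Where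
`a j = 0`, the entry is `0`, as division by zero yields `0`. -/
noncomputable def arcFactor (a : Fin n → ℝ) (N : Matrix (Fin n) (Fin n) ℝ) :
    Matrix (Fin n) (Fin n) ℝ :=
  Matrix.of fun i j => (if a i = 0 then 1 else 1 / 2) * N i j / a j

/-- Half the second derivative of the arc `(1 + t K) Diag(a) (1 + t K)ᵀ`. -/
noncomputable def arcCurvature (a : Fin n → ℝ) (N : Matrix (Fin n) (Fin n) ℝ) :
    Matrix (Fin n) (Fin n) ℝ :=
  arcFactor a N * Matrix.diagonal a * (arcFactor a N)ᵀ

theorem arcCurvature_isSymm (a : Fin n → ℝ) (N : Matrix (Fin n) (Fin n) ℝ) :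
    (arcCurvature a N).IsSymm := by
  simp [Matrix.IsSymm, arcCurvature, Matrix.transpose_mul, Matrix.mul_assoc]

theorem arcCurvature_apply_self {a : Fin n → ℝ} {N : Matrix (Fin n) (Fin n) ℝ}
    (hN : N.IsSymm) {j : Fin n} (hj : a j = 0) :
    arcCurvature a N j j = ∑ i, N i j ^ 2 / a i := by
  rw [arcCurvature, Matrix.mul_apply]
  refine sum_congr rfl fun i _ => ?_
  rw [Matrix.mul_diagonal, Matrix.transpose_apply, arcFactor, Matrix.of_apply, if_pos hj,
    one_mul, hN.apply]
  by_cases hi : a i = 0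
  · simp [hi]
  · field_simp

theorem posSemidef_arc {a : Fin n → ℝ} (ha : ∀ i, 0 ≤ a i) {N : Matrix (Fin n) (Fin n) ℝ}
    (hN : N.IsSymm) (h0 : ∀ i j, a i = 0 → a j = 0 → N i j = 0) (t : ℝ) :
    (Matrix.diagonal a + t • N + t ^ 2 • arcCurvature a N).PosSemidef := by
  set K := arcFactor a N with hK
  have hNK : N = K * Matrix.diagonal a + Matrix.diagonal a * Kᵀ := by
    ext i j
    rw [Matrix.add_apply, Matrix.mul_diagonal, Matrix.diagonal_mul, Matrix.transpose_apply, hK,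
      arcFactor, Matrix.of_apply, Matrix.of_apply, hN.apply i j]
    by_cases hi : a i = 0 <;> by_cases hj : a j = 0
    · simp [hi, hj, h0 i j hi hj]
    · simp [hi, hj]
    · simp [hi, hj, mul_div_cancel₀]
    · simp only [hi, hj, if_false]
      field_simp
      ring
  have h := (Matrix.posSemidef_diagonal_iff.2 ha).mul_mul_conjTranspose_same (1 + t • K)
  convert h using 1
  rw [Matrix.conjTranspose_eq_transpose_of_trivial, arcCurvature, ← hK]
  conv_lhs => rw [hNK]
  simp only [Matrix.transpose_add, Matrix.transpose_one, Matrix.transpose_smul, Matrix.add_mul,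
    Matrix.mul_add, Matrix.one_mul, Matrix.mul_one, Matrix.smul_mul, Matrix.mul_smul, smul_add,
    smul_smul, sq, Matrix.mul_assoc]
  abel

/-! ### The limiting quadratic form -/

/-- In the coordinates given by `P`, the symmetric matrices whose entries `(i, j)` vanish whenever
`a i = 0` and `b j ≠ 0`. For orthogonal `P` and complementary `a, b ≥ 0`, this is the affine hull
of the critical cone of `𝕊ⁿ₊` at `P Diag(a) Pᵀ` for `-P Diag(b) Pᵀ`. -/
def critSub (P : Matrix (Fin n) (Fin n) ℝ) (a b : Fin n → ℝ) : Submodule ℝ (SymMat n) where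
  carrier := {H | ∀ i j, a i = 0 → b j ≠ 0 → coord P H i j = 0}
  add_mem' := fun hA hB i j hi hj => by
    rw [coord_add, Matrix.add_apply, hA i j hi hj, hB i j hi hj, add_zero]
  zero_mem' := fun i j _ _ => by rw [coord_zero, Matrix.zero_apply]
  smul_mem' := fun c A hA i j hi hj => by
    rw [coord_smul, Matrix.smul_apply, hA i j hi hj, smul_zero]

/-- The form `∑ (b j / a i) (Pᵀ H P) i j ^ 2`, restricted to `critSub P a b`. As division by zero
yields `0`, only the indices with `a i ≠ 0` contribute. -/
noncomputable def quadFn (P : Matrix (Fin n) (Fin n) ℝ) (a b : Fin n → ℝ) (H : SymMat n) : EReal :=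
  ((∑ i, ∑ j, b j / a i * coord P H i j ^ 2 : ℝ) : EReal) +
    indicatorFn (critSub P a b : Set (SymMat n)) H

theorem isGeneralizedQuadraticForm_quadFn (P : Matrix (Fin n) (Fin n) ℝ) (a b : Fin n → ℝ) :
    IsGeneralizedQuadraticForm (quadFn P a b) := by
  set B : SymMat n →L[ℝ] SymMat n →L[ℝ] ℝ :=
    ∑ i, ∑ j, (b j / a i) • (coordCLM P i j).smulRight (coordCLM P i j) with hBdef
  have hB : ∀ x y, B x y = ∑ i, ∑ j, b j / a i * (coord P x i j * coord P y i j) := by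
    intro x y
    simp [hBdef, coordCLM_apply]
  convert isGeneralizedQuadraticForm_bilin_add_indicatorFn B
    (fun x y => by rw [hB, hB]; simp only [mul_comm (coord P x _ _)]) (critSub P a b) using 1
  ext H
  rw [quadFn, hB]
  simp only [sq]

theorem critSub_two_mul (P : Matrix (Fin n) (Fin n) ℝ) (a b : Fin n → ℝ) :
    critSub P a (fun i => 2 * b i) = critSub P a b := by
  ext H
  simp [critSub]

theorem half_mul_quadFn_two_mul (P : Matrix (Fin n) (Fin n) ℝ) (a b : Fin n → ℝ)
    (H : SymMat n) :
    ((1 / 2 : ℝ) : EReal) * quadFn P a (fun i => 2 * b i) H = quadFn P a b H := by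
  rw [quadFn, quadFn, critSub_two_mul]
  by_cases hH : H ∈ (critSub P a b : Set (SymMat n))
  · rw [add_indicatorFn_of_mem hH, add_indicatorFn_of_mem hH, ← EReal.coe_mul, mul_sum]
    congr 1
    refine sum_congr rfl fun i _ => ?_
    rw [mul_sum]
    exact sum_congr rfl fun j _ => by ring
  · rw [add_indicatorFn_of_notMem hH, add_indicatorFn_of_notMem hH,
      EReal.coe_mul_top_of_pos (by norm_num)]

/-! ### The second subderivative under strict complementarity -/

section Strict

variable {P : Matrix (Fin n) (Fin n) ℝ} {a b : Fin n → ℝ}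

theorem coord_diagSym_add_smul (hP : Pᵀ * P = 1) (t : ℝ) (u : SymMat n) :
    coord P (diagSym P a + t • u) = Matrix.diagonal a + t • coord P u := by
  rw [coord_add, coord_diagSym hP, coord_smul]

theorem secondDiffQuot_psdCone_of_mem (hP : Pᵀ * P = 1) (ha : ∀ i, 0 ≤ a i) {t : ℝ} (ht : 0 < t)
    {u : SymMat n} (hu : diagSym P a + t • u ∈ psdCone n) :
    secondDiffQuot (indicatorFn (psdCone n)) (diagSym P a) (diagSym P (-b)) t u =
      ((2 / t * ∑ j, b j * coord P u j j : ℝ) : EReal) := by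
  rw [secondDiffQuot_indicatorFn_of_mem (diagSym_mem_psdCone hP ha) hu, inner_diagSym hP]
  congr 1
  simp only [Pi.neg_apply, neg_mul, sum_neg_distrib]
  field_simp

/-- A lower bound for the second-order difference quotients that is continuous in `(t, u)`; at
`(0, H)` it takes the value of the second subderivative. -/
theorem le_secondDiffQuot_psdCone (hP : Pᵀ * P = 1) (ha : ∀ i, 0 ≤ a i) (hb : ∀ i, 0 ≤ b i)
    (hab : ∀ i, a i = 0 ∨ b i = 0) (N : Matrix (Fin n) (Fin n) ℝ) {t : ℝ} (ht : 0 < t)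
    (u : SymMat n) :
    ((2 * ∑ j, b j * (2 * ∑ i, coord P u i j * (N i j / a i) - ∑ i, N i j ^ 2 / a i -
        t * ∑ i, ∑ k, N i j / a i * coord P u i k * (N k j / a k)) : ℝ) : EReal) ≤
      secondDiffQuot (indicatorFn (psdCone n)) (diagSym P a) (diagSym P (-b)) t u := by
  by_cases hu : diagSym P a + t • u ∈ psdCone n
  · rw [secondDiffQuot_psdCone_of_mem hP ha ht hu, EReal.coe_le_coe_iff, div_mul_eq_mul_div,
      le_div_iff₀ ht, mul_assoc, sum_mul]
    refine mul_le_mul_of_nonneg_left (sum_le_sum fun j _ => ?_) zero_le_two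
    rw [mul_assoc]
    rcases hab j with hj | hj
    · refine mul_le_mul_of_nonneg_left ?_ (hb j)
      have hM := posSemidef_coord_of_mem P hu
      rw [coord_diagSym_add_smul hP] at hM
      have := posSemidef_diagonal_add_smul_test (coord_isSymm P u) ht hM hj
        (fun i => N i j / a i)
      have e : ∀ i, a i * (N i j / a i) ^ 2 = N i j ^ 2 / a i := fun i => by
        by_cases hi : a i = 0
        · simp [hi]
        · field_simp
      simp only [e] at this
      nlinarith
    · simp [hj]
  · rw [secondDiffQuot_indicatorFn_of_notMem ht (diagSym_mem_psdCone hP ha) hu]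
    exact le_top

/-- On the block of the zeros of `a`, the diagonal of a feasible direction dominates the block, so
that the difference quotients grow like `1 / t` near a direction with a nonzero entry there. -/
theorem le_secondDiffQuot_psdCone_of_zero_block (hP : Pᵀ * P = 1) (ha : ∀ i, 0 ≤ a i)
    (hb : ∀ i, 0 ≤ b i) (hab : ∀ i, a i = 0 ∨ b i = 0) {i j : Fin n} (hi : a i = 0)
    (hj : a j = 0) {t : ℝ} (ht : 0 < t) (u : SymMat n) :
    ((2 * min (b i) (b j) * |coord P u i j| * t⁻¹ : ℝ) : EReal) ≤
      secondDiffQuot (indicatorFn (psdCone n)) (diagSym P a) (diagSym P (-b)) t u := by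
  by_cases hu : diagSym P a + t • u ∈ psdCone n
  · rw [secondDiffQuot_psdCone_of_mem hP ha ht hu, EReal.coe_le_coe_iff]
    have hM := posSemidef_coord_of_mem P hu
    rw [coord_diagSym_add_smul hP] at hM
    have hentry := fun k l (hk : a k = 0) => diagonal_add_smul_apply (coord P u) t hk l
    have hdiag : ∀ k, a k = 0 → 0 ≤ coord P u k k := by
      intro k hk
      have := hM.diag_nonneg (i := k)
      rw [hentry k k hk] at this
      exact nonneg_of_mul_nonneg_right this ht
    have h2 : 2 * |coord P u i j| ≤ coord P u i i + coord P u j j := by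
      have := two_mul_abs_le_of_posSemidef hM i j
      rw [hentry i j hi, hentry i i hi, hentry j j hj, abs_mul, abs_of_pos ht] at this
      refine le_of_mul_le_mul_left ?_ ht
      linarith
    have hnn : ∀ k, 0 ≤ b k * coord P u k k := by
      intro k
      rcases hab k with hk | hk
      · exact mul_nonneg (hb k) (hdiag k hk)
      · simp [hk]
    have hsi := single_le_sum (fun k _ => hnn k) (mem_univ i)
    have hsj := single_le_sum (fun k _ => hnn k) (mem_univ j)
    have hmi := mul_le_mul_of_nonneg_right (min_le_left (b i) (b j)) (hdiag i hi)
    have hmj := mul_le_mul_of_nonneg_right (min_le_right (b i) (b j)) (hdiag j hj)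
    have hm := mul_le_mul_of_nonneg_left h2 (le_min (hb i) (hb j))
    have : min (b i) (b j) * |coord P u i j| ≤ ∑ k, b k * coord P u k k := by
      linarith
    calc 2 * min (b i) (b j) * |coord P u i j| * t⁻¹
        = 2 / t * (min (b i) (b j) * |coord P u i j|) := by ring
      _ ≤ _ := mul_le_mul_of_nonneg_left this (by positivity)
  · rw [secondDiffQuot_indicatorFn_of_notMem ht (diagSym_mem_psdCone hP ha) hu]
    exact le_top

theorem eventually_fst_pos (H : SymMat n) :
    ∀ᶠ p : ℝ × SymMat n in 𝓝[>] (0 : ℝ) ×ˢ 𝓝 H, 0 < p.1 :=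
  tendsto_fst.eventually self_mem_nhdsWithin

theorem epiConverges_secondDiffQuot_psdCone (hP : Pᵀ * P = 1) (ha : ∀ i, 0 ≤ a i)
    (hb : ∀ i, 0 ≤ b i) (hab : ∀ i, a i = 0 ∨ b i = 0) (hs : ∀ i, a i = 0 → b i ≠ 0) :
    EpiConverges (𝓝[>] (0 : ℝ))
      (fun t => secondDiffQuot (indicatorFn (psdCone n)) (diagSym P a) (diagSym P (-b)) t)
      (quadFn P a (fun i => 2 * b i)) := by
  have hzero : ∀ j, b j ≠ 0 → a j = 0 := fun j hj => (hab j).resolve_right hj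
  intro H
  have hle : 𝓝[>] (0 : ℝ) ×ˢ 𝓝 H ≤ 𝓝 ((0 : ℝ), H) := by
    rw [nhds_prod_eq]
    exact prod_mono nhdsWithin_le_nhds le_rfl
  by_cases hH : H ∈ critSub P a b
  · have hval : quadFn P a (fun i => 2 * b i) H =
        ((2 * ∑ j, b j * ∑ i, coord P H i j ^ 2 / a i : ℝ) : EReal) := by
      rw [quadFn, critSub_two_mul, add_indicatorFn_of_mem (C := (critSub P a b : Set (SymMat n))) hH,
        sum_comm, mul_sum]
      congr 1
      refine sum_congr rfl fun j _ => ?_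
      rw [mul_sum, mul_sum]
      exact sum_congr rfl fun i _ => by ring
    rw [hval]
    refine ⟨?_, fun t => H + t • ofCoord P (arcCurvature a (coord P H))
      (arcCurvature_isSymm _ _), ?_, ?_⟩
    -- At `(t, u) = (0, H)` the continuous lower bound equals the asserted value.
    · refine le_liminf_of_tendsto_of_le (f := fun p : ℝ × SymMat n =>
        ((2 * ∑ j, b j * (2 * ∑ i, coord P p.2 i j * (coord P H i j / a i) -
          ∑ i, coord P H i j ^ 2 / a i - p.1 * ∑ i, ∑ k,
            coord P H i j / a i * coord P p.2 i k * (coord P H k j / a k)) : ℝ) : EReal)) ?_ ?_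
      · refine (continuous_coe_real_ereal.tendsto _).comp ?_
        have hc : Continuous (fun p : ℝ × SymMat n =>
          (2 * ∑ j, b j * (2 * ∑ i, coord P p.2 i j * (coord P H i j / a i) -
          ∑ i, coord P H i j ^ 2 / a i - p.1 * ∑ i, ∑ k,
            coord P H i j / a i * coord P p.2 i k * (coord P H k j / a k)))) := by
          fun_prop
        convert (hc.tendsto (0, H)).mono_left hle using 2
        congr 1
        refine sum_congr rfl fun j _ => ?_
        congr 1
        have : ∀ i, coord P H i j * (coord P H i j / a i) = coord P H i j ^ 2 / a i :=
          fun i => by ring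
        simp only [this]
        ring
      · filter_upwards [eventually_fst_pos H] with p hp
        exact le_secondDiffQuot_psdCone hP ha hb hab (coord P H) hp p.2
    · have hc : Continuous (fun t : ℝ => H + t • ofCoord P (arcCurvature a (coord P H))
        (arcCurvature_isSymm _ _)) := by fun_prop
      convert (hc.tendsto 0).mono_left nhdsWithin_le_nhds using 2
      simp
    -- Along the arc, the difference quotient does not depend on `t`.
    · refine le_of_eq ?_
      rw [← limsup_const (f := 𝓝[>] (0 : ℝ))
        ((2 * ∑ j, b j * ∑ i, coord P H i j ^ 2 / a i : ℝ) : EReal)]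
      refine limsup_congr ?_
      filter_upwards [self_mem_nhdsWithin] with t ht
      have ht : 0 < t := ht
      have hblock : ∀ i j, a i = 0 → a j = 0 → coord P H i j = 0 :=
        fun i j hi hj => hH i j hi (hs j hj)
      have hcu : coord P (H + t • ofCoord P (arcCurvature a (coord P H))
          (arcCurvature_isSymm _ _)) = coord P H + t • arcCurvature a (coord P H) := by
        rw [coord_add, coord_smul, coord_ofCoord hP]
      rw [secondDiffQuot_psdCone_of_mem hP ha ht, hcu]
      · congr 1
        rw [div_mul_eq_mul_div, div_eq_iff ht.ne', mul_assoc, sum_mul]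
        congr 1
        refine sum_congr rfl fun j _ => ?_
        rcases hab j with hj | hj
        · have h0 : coord P H j j = 0 := hblock j j hj hj
          rw [Matrix.add_apply, Matrix.smul_apply, h0,
            arcCurvature_apply_self (coord_isSymm P H) hj, smul_eq_mul]
          ring
        · simp [hj]
      · refine mem_psdCone_of_coord hP ?_
        rw [coord_diagSym_add_smul hP, hcu, smul_add, smul_smul, ← sq, ← add_assoc]
        exact posSemidef_arc ha (coord_isSymm P H) hblock t
  · have hval : quadFn P a (fun i => 2 * b i) H = ⊤ := by
      rw [quadFn, critSub_two_mul]
      exact add_indicatorFn_of_notMem hH _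
    rw [hval]
    refine ⟨?_, fun _ => H, tendsto_const_nhds, le_top⟩
    have hex : ∃ i j, a i = 0 ∧ b j ≠ 0 ∧ coord P H i j ≠ 0 := by
      by_contra! hcon
      exact hH hcon
    obtain ⟨i, j, hi, hj, hij⟩ := hex
    refine le_liminf_of_tendsto_of_le (f := fun p : ℝ × SymMat n =>
      ((2 * min (b i) (b j) * |coord P p.2 i j| * p.1⁻¹ : ℝ) : EReal)) ?_ ?_
    · rw [EReal.tendsto_coe_nhds_top_iff]
      have hpos : 0 < 2 * min (b i) (b j) * |coord P H i j| := by
        have h1 : 0 < b i := lt_of_le_of_ne (hb i) (Ne.symm (hs i hi))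
        have h2 : 0 < b j := lt_of_le_of_ne (hb j) (Ne.symm hj)
        have h3 := lt_min h1 h2
        have h4 := abs_pos.2 hij
        positivity
      refine Tendsto.pos_mul_atTop hpos ?_ ?_
      · have hc : Continuous (fun u : SymMat n => 2 * min (b i) (b j) * |coord P u i j|) := by
          fun_prop
        exact (hc.tendsto H).comp tendsto_snd
      · exact tendsto_inv_nhdsGT_zero.comp tendsto_fst
    · filter_upwards [eventually_fst_pos H] with p hp
      exact le_secondDiffQuot_psdCone_of_zero_block hP ha hb hab hi (hzero j hj) hp p.2

theorem secondSubderiv_psdCone (hP : Pᵀ * P = 1) (ha : ∀ i, 0 ≤ a i)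
    (hb : ∀ i, 0 ≤ b i) (hab : ∀ i, a i = 0 ∨ b i = 0) (hs : ∀ i, a i = 0 → b i ≠ 0) :
    secondSubderiv (indicatorFn (psdCone n)) (diagSym P a) (diagSym P (-b)) =
      quadFn P a (fun i => 2 * b i) :=
  funext fun H => (epiConverges_secondDiffQuot_psdCone hP ha hb hab hs).eq_liminf H

theorem generalizedTwiceDifferentiableAt_psdCone (hP : Pᵀ * P = 1) (ha : ∀ i, 0 ≤ a i)
    (hb : ∀ i, 0 ≤ b i) (hab : ∀ i, a i = 0 ∨ b i = 0) (hs : ∀ i, a i = 0 → b i ≠ 0) :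
    GeneralizedTwiceDifferentiableAt (indicatorFn (psdCone n)) (diagSym P a)
      (diagSym P (-b)) := by
  have hx := diagSym_mem_psdCone hP ha
  refine ⟨mem_subdiff_indicatorFn hx fun z hz => ?_, ⟨?_, ?_, ?_⟩, ?_⟩
  · rw [inner_diagSym hP]
    refine sum_nonpos fun i _ => ?_
    rw [coord_sub, coord_diagSym hP, Matrix.sub_apply, Matrix.diagonal_apply_eq, Pi.neg_apply]
    have := (posSemidef_coord_of_mem P hz).diag_nonneg (i := i)
    rcases hab i with hi | hi
    · rw [hi]
      nlinarith [hb i]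
    · simp [hi]
  · simp [indicatorFn_of_mem hx]
  · simp [indicatorFn_of_mem hx]
  · rw [secondSubderiv_psdCone hP ha hb hab hs]
    exact epiConverges_secondDiffQuot_psdCone hP ha hb hab hs
  · rw [secondSubderiv_psdCone hP ha hb hab hs]
    exact isGeneralizedQuadraticForm_quadFn _ _ _

end Strict

/-! ### Membership in the quadratic bundle -/

/-- The zeros of `a` that are zeros of `b` are raised to `1 / (k + 1)`, which restores strict
complementarity. -/
noncomputable def perturb (a b : Fin n → ℝ) (k : ℕ) (i : Fin n) : ℝ :=
  if a i = 0 ∧ b i = 0 then 1 / ((k : ℝ) + 1) else a i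

theorem perturb_nonneg {a : Fin n → ℝ} (ha : ∀ i, 0 ≤ a i) (b : Fin n → ℝ) (k : ℕ)
    (i : Fin n) : 0 ≤ perturb a b k i := by
  rw [perturb]
  split_ifs
  · positivity
  · exact ha i

theorem tendsto_diagSym_perturb {P : Matrix (Fin n) (Fin n) ℝ} (hP : Pᵀ * P = 1)
    (a b : Fin n → ℝ) :
    Tendsto (fun k => diagSym P (perturb a b k)) atTop (𝓝 (diagSym P a)) := by
  set e : Fin n → ℝ := fun i => if a i = 0 ∧ b i = 0 then 1 else 0 with he
  have h : ∀ k : ℕ, diagSym P (perturb a b k) =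
      diagSym P a + (1 / ((k : ℝ) + 1)) • diagSym P e := by
    intro k
    apply coord_injective hP
    rw [coord_add, coord_smul, coord_diagSym hP, coord_diagSym hP, coord_diagSym hP,
      ← Matrix.diagonal_smul, Matrix.diagonal_add]
    congr 1
    ext i
    by_cases hi : a i = 0 ∧ b i = 0 <;> simp [perturb, he, hi]
  simp only [h]
  have := (tendsto_one_div_add_atTop_nhds_zero_nat (𝕜 := ℝ)).smul_const (diagSym P e)
  simpa using this.const_add (diagSym P a)

/-- As the raised zeros tend to `0`, their contributions `(k + 1) b j (Pᵀ H P) i j ^ 2` force the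
entries `(i, j)` to vanish in the epi-limit. -/
theorem epiConverges_quadFn_perturb {P : Matrix (Fin n) (Fin n) ℝ} {a b : Fin n → ℝ}
    (ha : ∀ i, 0 ≤ a i) (hb : ∀ i, 0 ≤ b i) :
    EpiConverges atTop (fun k => quadFn P (perturb a b k) b) (quadFn P a b) := by
  have hpos := perturb_nonneg ha b
  have hsub : ∀ k, critSub P a b ≤ critSub P (perturb a b k) b := by
    intro k H hH i j hi hj
    refine hH i j ?_ hj
    by_contra hai
    rw [perturb, if_neg (fun h => hai h.1)] at hi
    exact hai hi
  have hterm : ∀ (k : ℕ) (u : SymMat n) i j, a i ≠ 0 →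
      b j / perturb a b k i * coord P u i j ^ 2 = b j / a i * coord P u i j ^ 2 := by
    intro k u i j hi
    rw [perturb, if_neg (fun h => hi h.1)]
  have hnn : ∀ (k : ℕ) (u : SymMat n) i j, 0 ≤ b j / perturb a b k i * coord P u i j ^ 2 :=
    fun k u i j => mul_nonneg (div_nonneg (hb j) (hpos k i)) (sq_nonneg _)
  have hlow : ∀ (k : ℕ) (u : SymMat n),
      ((∑ i, ∑ j, b j / perturb a b k i * coord P u i j ^ 2 : ℝ) : EReal) ≤
        quadFn P (perturb a b k) b u := by
    intro k u
    by_cases hu : u ∈ (critSub P (perturb a b k) b : Set (SymMat n))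
    · rw [quadFn, add_indicatorFn_of_mem hu]
    · rw [quadFn, add_indicatorFn_of_notMem hu]
      exact le_top
  intro H
  by_cases hH : H ∈ critSub P a b
  · have hval : quadFn P a b H = ((∑ i, ∑ j, b j / a i * coord P H i j ^ 2 : ℝ) : EReal) :=
      add_indicatorFn_of_mem (C := (critSub P a b : Set (SymMat n))) hH _
    rw [hval]
    refine ⟨?_, fun _ => H, tendsto_const_nhds, ?_⟩
    · refine le_liminf_of_tendsto_of_le (f := fun p : ℕ × SymMat n =>
        ((∑ i, ∑ j, b j / a i * coord P p.2 i j ^ 2 : ℝ) : EReal)) ?_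
        (Eventually.of_forall fun p => le_trans ?_ (hlow p.1 p.2))
      · refine (continuous_coe_real_ereal.tendsto _).comp ?_
        have hc : Continuous (fun u : SymMat n =>
          ∑ i, ∑ j, b j / a i * coord P u i j ^ 2) := by fun_prop
        exact (hc.tendsto H).comp tendsto_snd
      · rw [EReal.coe_le_coe_iff]
        refine sum_le_sum fun i _ => sum_le_sum fun j _ => ?_
        by_cases hi : a i = 0
        · rw [hi, div_zero, zero_mul]
          exact hnn _ _ _ _
        · rw [hterm _ _ _ _ hi]
    -- At `H` itself the approximating forms all have the limit value.
    · refine le_of_eq ?_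
      rw [← limsup_const (f := (atTop : Filter ℕ))
        ((∑ i, ∑ j, b j / a i * coord P H i j ^ 2 : ℝ) : EReal)]
      congr 1
      ext k
      beta_reduce
      rw [quadFn, add_indicatorFn_of_mem (C := (critSub P (perturb a b k) b : Set (SymMat n)))
        (hsub k hH)]
      congr 1
      refine sum_congr rfl fun i _ => sum_congr rfl fun j _ => ?_
      by_cases hi : a i = 0
      · by_cases hj : b j = 0
        · simp [hj]
        · simp [hH i j hi hj]
      · rw [hterm _ _ _ _ hi]
  · have hval : quadFn P a b H = ⊤ := add_indicatorFn_of_notMem hH _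
    rw [hval]
    refine ⟨?_, fun _ => H, tendsto_const_nhds, le_top⟩
    have hex : ∃ i j, a i = 0 ∧ b j ≠ 0 ∧ coord P H i j ≠ 0 := by
      by_contra! hcon
      exact hH hcon
    obtain ⟨i, j, hi, hj, hij⟩ := hex
    have hbj : 0 < b j := lt_of_le_of_ne (hb j) (Ne.symm hj)
    by_cases hbi : b i = 0
    -- The raised entry `i` of `a` yields a single term that tends to infinity near `H`.
    · refine le_liminf_of_tendsto_of_le (f := fun p : ℕ × SymMat n =>
        ((b j * coord P p.2 i j ^ 2 * ((p.1 : ℝ) + 1) : ℝ) : EReal)) ?_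
        (Eventually.of_forall fun p => le_trans ?_ (hlow p.1 p.2))
      · rw [EReal.tendsto_coe_nhds_top_iff]
        have hpos' : 0 < b j * coord P H i j ^ 2 := by positivity
        refine Tendsto.pos_mul_atTop hpos' ?_ ?_
        · have hc : Continuous (fun u : SymMat n => b j * coord P u i j ^ 2) := by fun_prop
          exact (hc.tendsto H).comp tendsto_snd
        · exact (tendsto_atTop_add_const_right _ _ tendsto_natCast_atTop_atTop).comp tendsto_fst
      · rw [EReal.coe_le_coe_iff]
        have h1 := single_le_sum (f := fun i => ∑ j, b j / perturb a b p.1 i *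
          coord P p.2 i j ^ 2) (fun i _ => sum_nonneg fun j _ => hnn p.1 p.2 i j) (mem_univ i)
        have h2 := single_le_sum (f := fun j => b j / perturb a b p.1 i *
          coord P p.2 i j ^ 2) (fun j _ => hnn p.1 p.2 i j) (mem_univ j)
        refine le_trans (le_of_eq ?_) (h2.trans h1)
        rw [perturb, if_pos ⟨hi, hbi⟩, div_div_eq_mul_div, div_one]
        ring
    -- The entry `i` of `a` stays zero, and points near `H` lie outside every `critSub`.
    · refine le_liminf_of_tendsto_of_le (f := fun _ => ⊤) tendsto_const_nhds ?_
      have hc := continuous_coord_apply P i j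
      filter_upwards [tendsto_snd.eventually (hc.continuousAt.eventually_ne hij)] with p hp
      have hmem : p.2 ∉ (critSub P (perturb a b p.1) b : Set (SymMat n)) := by
        intro hmem
        refine hp (hmem i j ?_ hj)
        rw [perturb, if_neg (fun h => hbi h.2), hi]
      rw [quadFn, add_indicatorFn_of_notMem hmem]

/-- The approximating pairs are `P Diag(perturb a b k) Pᵀ` with the fixed multiplier
`-P Diag(b) Pᵀ`. -/
theorem quadFn_mem_quadBundle {P : Matrix (Fin n) (Fin n) ℝ} (hP : Pᵀ * P = 1)
    {a b : Fin n → ℝ} (ha : ∀ i, 0 ≤ a i) (hb : ∀ i, 0 ≤ b i)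
    (hab : ∀ i, a i = 0 ∨ b i = 0) :
    quadFn P a b ∈ quadBundle (indicatorFn (psdCone n)) (diagSym P a) (diagSym P (-b)) := by
  have ha' := perturb_nonneg ha b
  have hab' : ∀ k i, perturb a b k i = 0 ∨ b i = 0 := by
    intro k i
    rw [perturb]
    split_ifs with h
    · exact Or.inr h.2
    · exact hab i
  have hs : ∀ k i, perturb a b k i = 0 → b i ≠ 0 := by
    intro k i h hbi
    rw [perturb] at h
    split_ifs at h with h'
    · have : (0 : ℝ) < 1 / ((k : ℝ) + 1) := by positivity
      exact this.ne' h
    · exact h' ⟨h, hbi⟩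
  refine ⟨isGeneralizedQuadraticForm_quadFn P a b, fun k => diagSym P (perturb a b k),
    fun _ => diagSym P (-b), tendsto_diagSym_perturb hP a b, tendsto_const_nhds,
    fun k => generalizedTwiceDifferentiableAt_psdCone hP (ha' k) hb (hab' k) (hs k), ?_⟩
  convert epiConverges_quadFn_perturb (P := P) ha hb using 3 with k H
  rw [secondSubderiv_psdCone hP (ha' k) hb (hab' k) (hs k), half_mul_quadFn_two_mul]

/-! ### The affine hull of the critical cone -/

section AffineHull

variable {P : Matrix (Fin n) (Fin n) ℝ} {a b : Fin n → ℝ}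

theorem criticalCone_subset_critSub (hP : Pᵀ * P = 1) (hb : ∀ i, 0 ≤ b i)
    (hab : ∀ i, a i = 0 ∨ b i = 0) :
    criticalCone (psdCone n) (diagSym P a) (diagSym P (-b)) ⊆ critSub P a b := by
  rintro d ⟨⟨t, u, ht, -, hu, hmem⟩, hd⟩
  have hquad : ∀ (r s : ℝ) i j, a i = 0 → a j = 0 →
      0 ≤ r ^ 2 * coord P d i i + 2 * (r * s) * coord P d i j + s ^ 2 * coord P d j j := by
    intro r s i j hi hj
    have hc : Continuous (fun u : SymMat n => r ^ 2 * coord P u i i +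
      2 * (r * s) * coord P u i j + s ^ 2 * coord P u j j) := by fun_prop
    refine ge_of_tendsto' ((hc.tendsto d).comp hu) fun k => ?_
    have hM := posSemidef_coord_of_mem P (hmem k)
    rw [coord_diagSym_add_smul hP] at hM
    have h := posSemidef_entries_nonneg hM r s i j
    rw [diagonal_add_smul_apply _ _ hi, diagonal_add_smul_apply _ _ hi,
      diagonal_add_smul_apply _ _ hj] at h
    refine nonneg_of_mul_nonneg_right (a := t k) (h.trans_eq ?_) (ht k)
    simp only [Function.comp_apply]
    ring
  have hdiag : ∀ i, a i = 0 → 0 ≤ coord P d i i := fun i hi => by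
    simpa using hquad 1 0 i i hi hi
  have hnn : ∀ i, 0 ≤ b i * coord P d i i := by
    intro i
    rcases hab i with hi | hi
    · exact mul_nonneg (hb i) (hdiag i hi)
    · simp [hi]
  have hd : ⟪diagSym P (-b), d⟫ = 0 := hd
  rw [inner_diagSym hP] at hd
  simp only [Pi.neg_apply, neg_mul, sum_neg_distrib, neg_eq_zero] at hd
  rw [sum_eq_zero_iff_of_nonneg fun i _ => hnn i] at hd
  intro i j hi hj
  have hj0 : coord P d j j = 0 := (mul_eq_zero.1 (hd j (mem_univ j))).resolve_left hj
  have haj : a j = 0 := (hab j).resolve_right hj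
  -- A nonnegative quadratic polynomial in `r, s` without an `s ^ 2` term has no cross term.
  by_contra hne
  have h := hquad 1 (-(coord P d i i + 1) / (2 * coord P d i j)) i j hi haj
  have hs : 2 * (-(coord P d i i + 1) / (2 * coord P d i j)) * coord P d i j =
      -(coord P d i i + 1) := by
    field_simp
  rw [hj0] at h
  linarith

/-- A direction whose block on the zeros of `a` is positive semidefinite and vanishes where `b`
does not is critical. It is split as `N + R`, with `R` carrying that block. -/
theorem mem_criticalCone_of_coord (hP : Pᵀ * P = 1) (ha : ∀ i, 0 ≤ a i)
    (hab : ∀ i, a i = 0 ∨ b i = 0) {N R : Matrix (Fin n) (Fin n) ℝ} (hN : N.IsSymm)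
    (hN0 : ∀ i j, a i = 0 → a j = 0 → N i j = 0) (hR : R.PosSemidef)
    (hRb : ∀ j, b j ≠ 0 → R j j = 0) {H : SymMat n} (hH : coord P H = N + R) :
    H ∈ criticalCone (psdCone n) (diagSym P a) (diagSym P (-b)) := by
  refine ⟨⟨fun k => 1 / ((k : ℝ) + 1), fun k => H + (1 / ((k : ℝ) + 1)) •
    ofCoord P (arcCurvature a N) (arcCurvature_isSymm _ _), fun k => by positivity,
    tendsto_one_div_add_atTop_nhds_zero_nat, ?_, fun k => ?_⟩, ?_⟩
  · have := (tendsto_one_div_add_atTop_nhds_zero_nat (𝕜 := ℝ)).smul_const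
      (ofCoord P (arcCurvature a N) (arcCurvature_isSymm _ _))
    simpa using this.const_add H
  · refine mem_psdCone_of_coord hP ?_
    set t : ℝ := 1 / ((k : ℝ) + 1)
    have ht : 0 ≤ t := by positivity
    rw [coord_diagSym_add_smul hP, coord_add, coord_smul, coord_ofCoord hP, hH]
    have h := (posSemidef_arc ha hN hN0 t).add (hR.smul ht)
    convert h using 1
    rw [smul_add, smul_add, smul_smul, ← sq]
    abel
  · change ⟪diagSym P (-b), H⟫ = 0
    rw [inner_diagSym hP, hH]
    refine sum_eq_zero fun i _ => ?_
    rw [Matrix.add_apply, Pi.neg_apply]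
    by_cases hi : b i = 0
    · simp [hi]
    · have hai : a i = 0 := (hab i).resolve_right hi
      rw [hN0 i i hai hai, hRb i hi]
      simp

/-- The symmetric block `M` of `H` on the common zeros of `a` and `b` is a difference of positive
semidefinite blocks, by `4 M = (M + E)² - (M - E)²` with `E` the identity of the block. -/
theorem affineSpan_criticalCone (hP : Pᵀ * P = 1) (ha : ∀ i, 0 ≤ a i) (hb : ∀ i, 0 ≤ b i)
    (hab : ∀ i, a i = 0 ∨ b i = 0) :
    (affineSpan ℝ (criticalCone (psdCone n) (diagSym P a) (diagSym P (-b))) :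
      Set (SymMat n)) = critSub P a b := by
  set C := criticalCone (psdCone n) (diagSym P a) (diagSym P (-b)) with hC
  apply Set.Subset.antisymm
  · have h : affineSpan ℝ C ≤ (critSub P a b).toAffineSubspace :=
      affineSpan_le.2 (criticalCone_subset_critSub hP hb hab)
    exact fun H hH => h hH
  · intro H hH
    set T := coord P H with hT
    have hTs : T.IsSymm := coord_isSymm P H
    set e : Fin n → ℝ := fun i => if a i = 0 ∧ b i = 0 then 1 else 0 with he
    set M : Matrix (Fin n) (Fin n) ℝ := Matrix.of fun i j => e i * e j * T i j with hM
    have hMs : M.IsSymm := by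
      ext i j
      rw [Matrix.transpose_apply, hM, Matrix.of_apply, Matrix.of_apply, hTs.apply i j,
        mul_comm (e j)]
    set D := Matrix.diagonal e with hD
    have hee : ∀ i, e i * e i = e i := by
      intro i
      by_cases hi : a i = 0 ∧ b i = 0 <;> simp [he, hi]
    have hMD : M * D = M := by
      ext i j
      rw [hD, Matrix.mul_diagonal, hM, Matrix.of_apply]
      linear_combination (e i * T i j) * hee j
    have hDM : D * M = M := by
      ext i j
      rw [hD, Matrix.diagonal_mul, hM, Matrix.of_apply]
      linear_combination (e j * T i j) * hee i
    have hDD : D * D = D := by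
      rw [hD, Matrix.diagonal_mul_diagonal]
      congr 1
      ext i
      exact hee i
    have hsq : ∀ A : Matrix (Fin n) (Fin n) ℝ, A.IsSymm → (A * A).PosSemidef := by
      intro A hA
      have := Matrix.posSemidef_self_mul_conjTranspose A
      rwa [Matrix.conjTranspose_eq_transpose_of_trivial, hA.eq] at this
    have hDs : D.IsSymm := Matrix.isSymm_diagonal e
    set R₁ := (1 / 4 : ℝ) • ((M + D) * (M + D)) with hR₁
    set R₂ := (1 / 4 : ℝ) • ((M - D) * (M - D)) with hR₂
    have hR₁p : R₁.PosSemidef := (hsq _ (hMs.add hDs)).smul (by norm_num)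
    have hR₂p : R₂.PosSemidef := (hsq _ (hMs.sub hDs)).smul (by norm_num)
    have hdiff : R₁ - R₂ = M := by
      rw [hR₁, hR₂, ← smul_sub]
      have : (M + D) * (M + D) - (M - D) * (M - D) = (4 : ℝ) • M := by
        rw [Matrix.add_mul, Matrix.mul_add, Matrix.mul_add, Matrix.sub_mul, Matrix.mul_sub,
          Matrix.mul_sub, hMD, hDM, hDD]
        module
      rw [this, smul_smul]
      norm_num
    have hRb : ∀ A : Matrix (Fin n) (Fin n) ℝ, A * D = A → ∀ j, b j ≠ 0 →
        ((1 / 4 : ℝ) • (A * A)) j j = 0 := by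
      intro A hA j hj
      have hej : e j = 0 := by simp [he, hj]
      rw [← hA, ← Matrix.mul_assoc, hD, Matrix.smul_apply, Matrix.mul_diagonal, hej, mul_zero,
        smul_zero]
    have h1 : (M + D) * D = M + D := by rw [Matrix.add_mul, hMD, hDD]
    have h2 : (M - D) * D = M - D := by rw [Matrix.sub_mul, hMD, hDD]
    have hN0 : ∀ i j, a i = 0 → a j = 0 → (T - M) i j = 0 := by
      intro i j hi hj
      rw [Matrix.sub_apply, hM, Matrix.of_apply]
      by_cases hbj : b j = 0
      · by_cases hbi : b i = 0
        · simp [he, hi, hj, hbi, hbj]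
        · have : T j i = 0 := hH j i hj hbi
          rw [← hTs.apply i j, this]
          simp
      · have : T i j = 0 := hH i j hi hbj
        rw [this]
        simp
    obtain ⟨H₁, hH₁⟩ : ∃ H₁, coord P H₁ = T - M + R₁ :=
      ⟨ofCoord P _ ((hTs.sub hMs).add (isSymm_of_posSemidef hR₁p)), coord_ofCoord hP _ _⟩
    obtain ⟨H₂, hH₂⟩ : ∃ H₂, coord P H₂ = R₂ :=
      ⟨ofCoord P _ (isSymm_of_posSemidef hR₂p), coord_ofCoord hP _ _⟩
    have hC₁ : H₁ ∈ C :=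
      mem_criticalCone_of_coord hP ha hab (hTs.sub hMs) hN0 hR₁p (hRb _ h1) hH₁
    have hC₂ : H₂ ∈ C :=
      mem_criticalCone_of_coord (N := 0) hP ha hab Matrix.isSymm_zero (fun _ _ _ _ => rfl) hR₂p
        (hRb _ h2) (by rw [hH₂, zero_add])
    have hC₀ : (0 : SymMat n) ∈ C :=
      mem_criticalCone_of_coord (N := 0) (R := 0) hP ha hab Matrix.isSymm_zero
        (fun _ _ _ _ => rfl) Matrix.PosSemidef.zero (fun _ _ => rfl)
        (by rw [coord_zero, zero_add])
    have hsplit : H = (1 : ℝ) • (H₁ -ᵥ H₂) +ᵥ (0 : SymMat n) := by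
      apply coord_injective hP
      rw [one_smul, vadd_eq_add, add_zero, vsub_eq_sub, coord_sub, hH₁, hH₂, ← hT,
        add_sub_assoc, hdiff, sub_add_cancel]
    rw [hsplit]
    exact AffineSubspace.smul_vsub_vadd_mem _ 1 (subset_affineSpan ℝ C hC₁)
      (subset_affineSpan ℝ C hC₂) (subset_affineSpan ℝ C hC₀)

end AffineHull

/-! ### Simultaneous diagonalization of a complementary pair -/

/-- Each row of `M` is determined by the sign of the eigenvalue: the diagonal entries of
`M² = M Diag(lam)` and `(Diag(lam) - M)² = (Diag(lam) - M) Diag(lam)` are sums of squares. -/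
theorem eq_diagonal_of_complementary {M : Matrix (Fin n) (Fin n) ℝ} {lam : Fin n → ℝ}
    (hM : M.PosSemidef) (hN : (M - Matrix.diagonal lam).PosSemidef)
    (h : M * (M - Matrix.diagonal lam) = 0) :
    M = Matrix.diagonal fun i => max (lam i) 0 := by
  have hMs : M.IsSymm := isSymm_of_posSemidef hM
  have hNs : (M - Matrix.diagonal lam).IsSymm := hMs.sub (Matrix.isSymm_diagonal lam)
  have h1 : M * M = M * Matrix.diagonal lam := by
    rw [Matrix.mul_sub, sub_eq_zero] at h
    exact h
  have h2 : (M - Matrix.diagonal lam) * (M - Matrix.diagonal lam) =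
      -(Matrix.diagonal lam * (M - Matrix.diagonal lam)) := by
    rw [Matrix.sub_mul, h, zero_sub]
  have hrow : ∀ A : Matrix (Fin n) (Fin n) ℝ, A.IsSymm → ∀ i, (A * A) i i ≤ 0 →
      ∀ j, A i j = 0 := by
    intro A hA i hi j
    rw [Matrix.mul_apply] at hi
    simp only [hA.apply i] at hi
    have h0 := (sum_eq_zero_iff_of_nonneg fun k _ => mul_self_nonneg (A i k)).1
      (le_antisymm hi (sum_nonneg fun k _ => mul_self_nonneg (A i k)))
    exact mul_self_eq_zero.1 (h0 j (mem_univ j))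
  ext i j
  rcases le_or_gt (lam i) 0 with hi | hi
  · rw [hrow M hMs i ?_ j]
    · by_cases hij : i = j
      · subst hij
        simp [hi]
      · simp [hij]
    · rw [h1, Matrix.mul_diagonal]
      exact mul_nonpos_of_nonneg_of_nonpos hM.diag_nonneg hi
  · have := hrow _ hNs i (by
      rw [h2, Matrix.neg_apply, Matrix.diagonal_mul, neg_nonpos]
      exact mul_nonneg hi.le hN.diag_nonneg) j
    rw [Matrix.sub_apply, sub_eq_zero] at this
    rw [this]
    by_cases hij : i = j
    · subst hij
      simp [hi.le]
    · simp [hij]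

/-- An orthogonal diagonalization of `X + Y` diagonalizes a complementary pair `(X, Y)`. -/
theorem eq_diagSym_of_complementary {X Y : SymMat n} (hX : X ∈ psdCone n) (hY : Y ∈ nsdCone n)
    (hXY : ⟪X, Y⟫ = 0) {P : Matrix (Fin n) (Fin n) ℝ} (hP : Pᵀ * P = 1) {lam : Fin n → ℝ}
    (h : (X + Y).mat = P * Matrix.diagonal lam * Pᵀ) :
    X = diagSym P (fun i => max (lam i) 0) ∧ Y = diagSym P (-fun i => max (-lam i) 0) := by
  have hsum : coord P X + coord P Y = Matrix.diagonal lam := by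
    rw [← coord_add, ← coord_diagSym hP]
    congr 1
    exact SymMat.ext h
  have hXc := posSemidef_coord_of_mem P hX
  have hY' : (-1 : ℝ) • Y ∈ psdCone n := by
    have : (-Y.mat).PosSemidef := hY
    change ((-1 : ℝ) • Y).mat.PosSemidef
    rwa [SymMat.mat_smul, neg_one_smul]
  have hYc := posSemidef_coord_of_mem P hY'
  have hYe : coord P ((-1 : ℝ) • Y) = coord P X - Matrix.diagonal lam := by
    rw [coord_smul, ← hsum]
    module
  have hprod : coord P X * coord P ((-1 : ℝ) • Y) = 0 := by
    refine mul_eq_zero_of_posSemidef_of_trace_mul_eq_zero hXc hYc ?_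
    rw [← inner_eq_trace_coord hP, inner_smul_right, hXY, mul_zero]
  rw [hYe] at hYc hprod
  have hXd := eq_diagonal_of_complementary hXc hYc hprod
  constructor
  · apply coord_injective hP
    rw [coord_diagSym hP, hXd]
  · apply coord_injective hP
    rw [coord_diagSym hP, ← add_right_inj (coord P X), hsum, hXd, Matrix.diagonal_add]
    congr 1
    ext i
    rcases le_total (lam i) 0 with hi | hi <;> simp [hi]

theorem exists_orthogonal_diagonalization (A : SymMat n) :
    ∃ (P : Matrix (Fin n) (Fin n) ℝ) (d : Fin n → ℝ),
      Pᵀ * P = 1 ∧ A.mat = P * Matrix.diagonal d * Pᵀ := by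
  have hA : A.mat.IsHermitian := by
    rw [Matrix.IsHermitian, Matrix.conjTranspose_eq_transpose_of_trivial]
    exact A.isSymm
  refine ⟨hA.eigenvectorUnitary, hA.eigenvalues, ?_, ?_⟩
  · have := Unitary.coe_star_mul_self hA.eigenvectorUnitary
    rwa [Matrix.star_eq_conjTranspose, Matrix.conjTranspose_eq_transpose_of_trivial] at this
  · have := hA.spectral_theorem
    rw [Unitary.conjStarAlgAut_apply, Matrix.star_eq_conjTranspose,
      Matrix.conjTranspose_eq_transpose_of_trivial] at this
    exact this

/-! ### The σ-term in coordinates -/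

theorem IsMoorePenroseInverse.unique {A B C : Matrix (Fin n) (Fin n) ℝ}
    (hB : IsMoorePenroseInverse A B) (hC : IsMoorePenroseInverse A C) : B = C := by
  have h1 : A * B = A * C := by
    calc A * B = (A * B)ᵀ := hB.symm_left.eq.symm
      _ = (A * C * (A * B))ᵀ := by rw [← Matrix.mul_assoc, hC.mul_mul_left]
      _ = A * B * (A * C) := by rw [Matrix.transpose_mul, hB.symm_left.eq, hC.symm_left.eq]
      _ = A * C := by rw [← Matrix.mul_assoc, hB.mul_mul_left]
  have h2 : B * A = C * A := by
    calc B * A = (B * A)ᵀ := hB.symm_right.eq.symm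
      _ = (B * A * (C * A))ᵀ := by
        rw [Matrix.mul_assoc, ← Matrix.mul_assoc A, hC.mul_mul_left]
      _ = C * A * (B * A) := by rw [Matrix.transpose_mul, hB.symm_right.eq, hC.symm_right.eq]
      _ = C * A := by rw [Matrix.mul_assoc, ← Matrix.mul_assoc A, hB.mul_mul_left]
  calc B = B * A * B := hB.mul_mul_right.symm
    _ = C * (A * B) := by rw [h2, Matrix.mul_assoc]
    _ = C := by rw [h1, ← Matrix.mul_assoc, hC.mul_mul_right]

theorem pinv_diagSym {P : Matrix (Fin n) (Fin n) ℝ} (hP : Pᵀ * P = 1) (d : Fin n → ℝ) :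
    pinv (diagSym P d) = P * Matrix.diagonal d⁻¹ * Pᵀ := by
  refine (pinv_spec (diagSym P d)).unique ?_
  have hd : (diagSym P d).mat = P * Matrix.diagonal d * Pᵀ := rfl
  have key : ∀ r s : Fin n → ℝ, P * Matrix.diagonal r * Pᵀ * (P * Matrix.diagonal s * Pᵀ) =
      P * Matrix.diagonal (r * s) * Pᵀ := by
    intro r s
    calc P * Matrix.diagonal r * Pᵀ * (P * Matrix.diagonal s * Pᵀ)
        = P * Matrix.diagonal r * (Pᵀ * P) * Matrix.diagonal s * Pᵀ := by
          simp only [Matrix.mul_assoc]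
      _ = P * (Matrix.diagonal r * Matrix.diagonal s) * Pᵀ := by
          rw [hP, Matrix.mul_one, Matrix.mul_assoc P]
      _ = _ := by
          rw [Matrix.diagonal_mul_diagonal]
          rfl
  have symm : ∀ r : Fin n → ℝ, (P * Matrix.diagonal r * Pᵀ).IsSymm := fun r =>
    (diagSym P r).isSymm
  refine ⟨?_, ?_, ?_, ?_⟩
  · rw [hd, key, key]
    congr 3
    ext i
    simp
  · rw [hd, key, key]
    congr 3
    ext i
    by_cases h : d i = 0 <;> simp [h]
  · rw [hd, key]
    exact symm _
  · rw [hd, key]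
    exact symm _

theorem neg_half_sigmaTerm_diagSym {P : Matrix (Fin n) (Fin n) ℝ} (hP : Pᵀ * P = 1)
    (a b : Fin n → ℝ) (H : SymMat n) :
    -(1 / 2) * sigmaTerm (diagSym P a) (diagSym P (-b)) H =
      ∑ i, ∑ j, b j / a i * coord P H i j ^ 2 := by
  have hY : (diagSym P (-b)).matᵀ = P * Matrix.diagonal (-b) * Pᵀ := (diagSym P (-b)).isSymm
  have htr : ((diagSym P (-b)).matᵀ * (H.mat * pinv (diagSym P a) * H.mat)).trace =
      (Matrix.diagonal (-b) * (coord P H * Matrix.diagonal a⁻¹ * coord P H)).trace := by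
    rw [hY, pinv_diagSym hP, coord]
    calc _ = (P * (Matrix.diagonal (-b) * Pᵀ * H.mat * P * Matrix.diagonal a⁻¹ * Pᵀ *
          H.mat)).trace := by simp only [Matrix.mul_assoc]
      _ = _ := by
        rw [Matrix.trace_mul_comm]
        simp only [Matrix.mul_assoc]
  rw [sigmaTerm, htr, Matrix.trace, sum_comm, mul_sum, mul_sum]
  refine sum_congr rfl fun j _ => ?_
  rw [Matrix.diag_apply, Matrix.diagonal_mul, Matrix.mul_apply, Pi.neg_apply, mul_sum, mul_sum,
    mul_sum]
  refine sum_congr rfl fun i _ => ?_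
  rw [Matrix.mul_diagonal, (coord_isSymm P H).apply i j, Pi.inv_apply]
  ring

/-- Only pairs of a positive and a negative eigenvalue contribute to the form. -/
theorem sum_div_mul_sq_eq_sum_filter (lam : Fin n → ℝ) (T : Matrix (Fin n) (Fin n) ℝ) :
    ∑ i, ∑ j, max (-lam j) 0 / max (lam i) 0 * T i j ^ 2 =
      ∑ i with 0 < lam i, ∑ j with lam j < 0, -lam j / lam i * T i j ^ 2 := by
  rw [sum_filter]
  refine sum_congr rfl fun i _ => ?_
  split_ifs with hi
  · rw [sum_filter]
    refine sum_congr rfl fun j _ => ?_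
    split_ifs with hj
    · rw [max_eq_left hi.le, max_eq_left (by linarith)]
    · rw [max_eq_right (a := -lam j) (by linarith)]
      simp
  · rw [max_eq_right (not_lt.1 hi)]
    simp

end NLSDP

theorem mainTheorem3 {X : Type*} [NormedAddCommGroup X] [InnerProductSpace ℝ X]
    [FiniteDimensional ℝ X] {n : ℕ} (f : X → ℝ) (G : X → SymMat n)
    (hf : ContDiff ℝ 2 f) (hG : ContDiff ℝ 2 G) (x : X) (Y : SymMat n)
    (hKKT : IsKKTPair f G x Y) :
    ∃ q ∈ quadBundle (indicatorFn (psdCone n)) (G x) Y,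
      (∀ H : SymMat n, q H = ((-(1 / 2) * sigmaTerm (G x) Y H : ℝ) : EReal) +
        indicatorFn (affineSpan ℝ (criticalCone (psdCone n) (G x) Y) : Set (SymMat n)) H) ∧
      ∀ (P : Matrix (Fin n) (Fin n) ℝ) (lam : Fin n → ℝ),
        IsOrderedEigendecomposition (G x + Y) P lam →
        ∀ H : SymMat n, q H =
          ((∑ i with 0 < lam i, ∑ j with lam j < 0,
            -lam j / lam i * ((Pᵀ * H.mat * P) i j) ^ 2 : ℝ) : EReal) +
          indicatorFn (affineSpan ℝ (criticalCone (psdCone n) (G x) Y) : Set (SymMat n)) H := by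
  obtain ⟨-, hX, hY, hXY⟩ := hKKT
  have hcompl : ∀ μ : Fin n → ℝ, ∀ i, max (μ i) 0 = 0 ∨ max (-μ i) 0 = 0 := by
    intro μ i
    rcases le_total (μ i) 0 with hi | hi
    · exact Or.inl (max_eq_right hi)
    · exact Or.inr (max_eq_right (by linarith))
  obtain ⟨Q, μ, hQ, hμ⟩ := exists_orthogonal_diagonalization (G x + Y)
  obtain ⟨hXQ, hYQ⟩ := eq_diagSym_of_complementary hX hY hXY hQ hμ
  have hμ0 : ∀ i, 0 ≤ max (μ i) 0 := fun i => le_max_right _ _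
  have hμ0' : ∀ i, 0 ≤ max (-μ i) 0 := fun i => le_max_right _ _
  have hq : ∀ H, quadFn Q (fun i => max (μ i) 0) (fun i => max (-μ i) 0) H =
      ((-(1 / 2) * sigmaTerm (G x) Y H : ℝ) : EReal) +
        indicatorFn (affineSpan ℝ (criticalCone (psdCone n) (G x) Y) : Set (SymMat n)) H := by
    intro H
    rw [hXQ, hYQ, affineSpan_criticalCone hQ hμ0 hμ0' (hcompl μ), neg_half_sigmaTerm_diagSym hQ,
      quadFn]
  refine ⟨quadFn Q (fun i => max (μ i) 0) (fun i => max (-μ i) 0), ?_, hq, ?_⟩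
  · rw [hXQ, hYQ]
    exact quadFn_mem_quadBundle hQ hμ0 hμ0' (hcompl μ)
  · rintro P lam ⟨hP, -, hlam⟩ H
    have hP : Pᵀ * P = 1 := (Matrix.mem_orthogonalGroup_iff' _ _).1 hP
    obtain ⟨hXP, hYP⟩ := eq_diagSym_of_complementary hX hY hXY hP hlam
    rw [hq H]
    congr 2
    rw [← sum_div_mul_sq_eq_sum_filter lam (Pᵀ * H.mat * P), hXP, hYP,
      neg_half_sigmaTerm_diagSym hP]
    rfl
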